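/- Let $d\ge 1$ be an integer, let $0<a<d$ and $0<b\le a/2$, and let $\mu$ be a Borel probability measure on $\mathbb R^d$, with Fourier transform $\widehat\mu(\xi)=\int e^{-2\pi i\langle x,\xi\rangle}\,d\mu(x)$. Assume that, for constants $A\ge 1$ and $B\ge 1$, $$\mu(\mathcal B)\le A\,\mathrm{rad}(\mathcal B)^a \ \text{ for every ball } \mathcal B \text{ of radius } \mathrm{rad}(\mathcal B)\le 1,\qquad |\xi|^b\,|\widehat\mu(\xi)|\le B\ \text{ for all } |\xi|\ge 1 .$$ For $0<p<\infty$ and $0<s\le\infty$ let $L^{p,s}=L^{p,s}(\mathbb R^d)$ be the Lorentz space with the (quasi-)norm $$\|f\|_{L^{p,s}}=p^{1/s}\Big(\int_0^\infty \big(t\,|\{x:|f(x)|>t\}|^{1/p}\big)^s\,\frac{dt}{t}\Big)^{1/s}\ (s<\infty),\qquad \|f\|_{L^{p,\infty}}=\sup_{t>0}\,t\,|\{x:|f(x)|>t\}|^{1/p},$$ and write $p'=p/(p-1)$. An operator is said to be of restricted weak type $(p,q)$ if it is bounded from $L^{p,1}$ to $L^{q,\infty}$. Let $Tf=f*\widehat\mu$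 and $$\rho=\frac{(d-a+2b)(d-a+b)}{(d-a)^2+3b(d-a)+b^2},\qquad \sigma=\frac{d-a+2b}{b},\qquad p_\circ=\frac{2(d-a+b)}{2(d-a)+b}.$$ (i) $T$ is of restricted weak type $(\rho,\sigma)$ and of restricted weak type $(\sigma',\rho')$, in both cases with operator norm at most $C\,A^{\frac{b}{d-a+b}}B^{\frac{d-a}{d-a+b}}$, where $C$ depends only on $d,a,b$. (ii) If $\rho<p<\sigma'$ and $\frac1p-\frac1q=\frac{d-a}{d-a+b}$, then for every $s\in(0,\infty]$ and every $f\in L^{p,s}$ $$\|f*\widehat\mu\|_{L^{q,s}}\le C\,A^{\frac{b}{d-a+b}}B^{\frac{d-a}{d-a+b}}\,\|f\|_{L^{p,s}},$$ where $C$ depends only on $d,a,b,p,s$. (iii) In particular, for every $s\in(0,\infty]$, the inequality in (ii) holds with $p=p_\circ$ and $q=p_\circ'$. In all three cases the integral $f*\widehat\mu(x)=\int f(y)\,\widehat\mu(x-y)\,dy$ converges absolutely for every $x\in\mathbb R^d$ and every $f$ in the domain space. -/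

import Mathlib

open MeasureTheory
open scoped ENNReal NNReal

noncomputable section

namespace SteinTomas

/-- `ℝ^d` with its Euclidean norm and Lebesgue measure. -/
abbrev E (d : ℕ) : Type := EuclideanSpace ℝ (Fin d)

/-- The Fourier transform `μ̂(ξ) = ∫ e^{-2πi⟨x,ξ⟩} dμ(x)` of a measure on `ℝ^d`. -/
def fourierMeasure {d : ℕ} (μ : Measure (E d)) (ξ : E d) : ℂ :=
  ∫ x, Complex.exp (-(2 * (Real.pi : ℂ) * ((inner ℝ x ξ : ℝ) : ℂ) * Complex.I)) ∂μ

/-- The ball condition `μ(𝓑) ≤ A rad(𝓑)^a` for all balls of radius at most `1`. -/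
def BallCondition {d : ℕ} (μ : Measure (E d)) (a A : ℝ) : Prop :=
  ∀ (x : E d) (r : ℝ), 0 < r → r ≤ 1 → μ (Metric.ball x r) ≤ ENNReal.ofReal (A * r ^ a)

/-- The Fourier decay condition `|ξ|^b |μ̂(ξ)| ≤ B` for all `|ξ| ≥ 1`. -/
def FourierDecay {d : ℕ} (μ : Measure (E d)) (b B : ℝ) : Prop :=
  ∀ ξ : E d, 1 ≤ ‖ξ‖ → ‖ξ‖ ^ b * ‖fourierMeasure μ ξ‖ ≤ B

/-- The distribution function `t ↦ |{x : |f(x)| > t}|`. -/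
def distribution {d : ℕ} (f : E d → ℂ) (t : ℝ) : ℝ≥0∞ :=
  volume {x | t < ‖f x‖}

/-- The Lorentz (quasi-)norm of `L^{p,s}(ℝ^d)`, for `0 < p < ∞` and `0 < s ≤ ∞`. For `s < ∞` it is
`p^{1/s} (∫_0^∞ (t |{|f| > t}|^{1/p})^s dt/t)^{1/s}`, which equals
`(∫_0^∞ (t^{1/p} f^*(t))^s dt/t)^{1/s}` where `f^*` is the decreasing rearrangement of `f`;
for `s = ∞` it is `sup_{t > 0} t |{|f| > t}|^{1/p} = sup_{t > 0} t^{1/p} f^*(t)`. -/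
def lorentzNorm {d : ℕ} (f : E d → ℂ) (p : ℝ) (s : ℝ≥0∞) : ℝ≥0∞ :=
  if s = ∞ then
    ⨆ t : Set.Ioi (0 : ℝ), ENNReal.ofReal t * distribution f t ^ (1 / p)
  else
    ENNReal.ofReal p ^ (1 / s.toReal) *
      (∫⁻ t in Set.Ioi (0 : ℝ),
        (ENNReal.ofReal t * distribution f t ^ (1 / p)) ^ s.toReal / ENNReal.ofReal t)
          ^ (1 / s.toReal)

/-- Membership in the Lorentz space `L^{p,s}(ℝ^d)`. -/
def MemLorentz {d : ℕ} (f : E d → ℂ) (p : ℝ) (s : ℝ≥0∞) : Prop :=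
  AEStronglyMeasurable f volume ∧ lorentzNorm f p s < ∞

/-- The convolution `(f * k)(x) = ∫ f(y) k(x - y) dy`. -/
def conv {d : ℕ} (f k : E d → ℂ) : E d → ℂ :=
  convolution f k (ContinuousLinearMap.mul ℂ ℂ) volume

/-- Convolution with `k` is bounded from `L^{p,r}` to `L^{q,s}` with operator norm at most `K`.
The integral defining `(f * k)(x)` is required to converge absolutely at every `x`. -/
def ConvBounded {d : ℕ} (k : E d → ℂ) (p : ℝ) (r : ℝ≥0∞) (q : ℝ) (s : ℝ≥0∞) (K : ℝ) : Prop :=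
  ∀ f : E d → ℂ, MemLorentz f p r →
    ConvolutionExists f k (ContinuousLinearMap.mul ℂ ℂ) volume ∧
    MemLorentz (conv f k) q s ∧
    lorentzNorm (conv f k) q s ≤ ENNReal.ofReal K * lorentzNorm f p r

/-- Convolution with `k` is of restricted weak type `(p,q)`, that is, bounded from `L^{p,1}` to
`L^{q,∞}`, with operator norm at most `K`. -/
def ConvRestrictedWeakType {d : ℕ} (k : E d → ℂ) (p q K : ℝ) : Prop :=
  ConvBounded k p 1 q ∞ K

/-- `ρ = (d-a+2b)(d-a+b) / ((d-a)² + 3b(d-a) + b²)`. -/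
def rhoExp (d : ℕ) (a b : ℝ) : ℝ :=
  ((d - a + 2 * b) * (d - a + b)) / ((d - a) ^ 2 + 3 * b * (d - a) + b ^ 2)

/-- `σ = (d-a+2b) / b`. -/
def sigmaExp (d : ℕ) (a b : ℝ) : ℝ := (d - a + 2 * b) / b

/-- `p_∘ = 2(d-a+b) / (2(d-a)+b)`. -/
def pCirc (d : ℕ) (a b : ℝ) : ℝ := (2 * (d - a + b)) / (2 * (d - a) + b)

/-- `A^{b/(d-a+b)} B^{(d-a)/(d-a+b)}`. -/
def normBound (d : ℕ) (a b A B : ℝ) : ℝ :=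
  A ^ (b / (d - a + b)) * B ^ ((d - a) / (d - a + b))

end SteinTomas

end

noncomputable section

namespace SteinTomas

variable {d : ℕ}

/-! Write `D = d - a`. All bounds are proved for the bilinear form `form k f g = ∬ f(y) g(x) k(x -
y)` with `|f|, |g| ≤ 1`, in terms of the `L¹` norms of `f` and `g`, so that they are restricted type
estimates. Multiplying `μ̂` by `e^{-πt|ξ|²}` amounts to convolving `μ` with a Gaussian at scale
`√t`; by the ball condition the resulting density is `≲ A t^{-D/2}`. Conversely `μ̂ (1 -
e^{-πr|ξ|²})^N` with `N ≥ b/2` is `≲ B r^{b/2}` by the Fourier decay. The binomial formula writes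
`μ̂` as the second kernel plus a combination of kernels damped at times at least `r`
(`dampedKer_eq`).

The argument is a two-step bootstrap. If the density is at most `S`, positivity, Cauchy–Schwarz and
Bessel give the `T T^*` inequality `|form(f, g)|² ≤ S · |form(f, f̄)| · ‖g‖₁`
(`sq_norm_form_dampedKer_le`). Inserting the trivial bound `|form(f, f̄)| ≤ S ‖f‖₁` and optimising
in `r` yields the estimate at `(p_∘, p_∘')`, uniformly over all dampings (`norm_form_dampedKer_le`).
Inserting this estimate in place of the trivial one and optimising again yields the endpoint `(ρ,
σ)` (`norm_form_fourierMeasure_le`); it is asymmetric because only the diagonal form in `f` has been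
improved. Since `μ̂(-ξ)` is the conjugate of `μ̂(ξ)`, the dual endpoint `(σ', ρ')` follows.

Both endpoints lie on the line `1/p - 1/q = D/(D+b)`. Slicing `f` into level sets turns the two
bilinear bounds into `u m ≤ K ∫ min(l^α' m^α, l^α m^α') dt`, where `l` is the distribution function
of `f` and `m` is the measure of a set where `|f * μ̂| > u` (`RestrictedKernel.conv_bound`). One
term of the minimum gives restricted weak type; both together give Marcinkiewicz interpolation with
the same second index `s`, quasi-norm range included (`lorentzOf_le_of_layerInt`). The point `p_∘`
is the midpoint of the segment. -/

/-- The character `e^{-2πi⟨x,ξ⟩}`. -/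
def phase (x ξ : E d) : ℂ :=
  Complex.exp (-(2 * (Real.pi : ℂ) * ((inner ℝ x ξ : ℝ) : ℂ) * Complex.I))

lemma fourierMeasure_eq (μ : Measure (E d)) (ξ : E d) :
    fourierMeasure μ ξ = ∫ x, phase x ξ ∂μ := rfl

lemma norm_phase (x ξ : E d) : ‖phase x ξ‖ = 1 := by
  have : phase x ξ = Complex.exp (((-(2 * Real.pi * inner ℝ x ξ) : ℝ) : ℂ) * Complex.I) := by
    unfold phase; congr 1; push_cast; ring
  rw [this, Complex.norm_exp_ofReal_mul_I]

lemma phase_add_left (x y ξ : E d) : phase (x + y) ξ = phase x ξ * phase y ξ := by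
  unfold phase; rw [← Complex.exp_add, inner_add_left]; congr 1; push_cast; ring

lemma phase_comm (x y : E d) : phase x y = phase y x := by
  unfold phase; rw [real_inner_comm]

lemma phase_add_right (x ξ η : E d) : phase x (ξ + η) = phase x ξ * phase x η := by
  rw [phase_comm, phase_add_left, phase_comm ξ, phase_comm η]

lemma conj_phase (x ξ : E d) : (starRingEnd ℂ) (phase x ξ) = phase x (-ξ) := by
  unfold phase; rw [← Complex.exp_conj]; congr 1
  simp [inner_neg_right, Complex.conj_ofNat]

lemma phase_neg_left (x ξ : E d) : phase (-x) ξ = phase x (-ξ) := by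
  unfold phase; simp

@[fun_prop]
lemma continuous_phase : Continuous fun p : E d × E d => phase p.1 p.2 := by
  unfold phase; fun_prop

/-! ### Gaussian multipliers and their kernels. -/

/-- The Gaussian multiplier `e^{-πt|ξ|²}`. -/
def gaussMul (t : ℝ) (ξ : E d) : ℝ := Real.exp (-(Real.pi * t * ‖ξ‖ ^ 2))

/-- The Gaussian kernel `t^{-d/2} e^{-π|x|²/t}`, the Fourier transform of `gaussMul t`. -/
def gaussKer (t : ℝ) (x : E d) : ℝ := t ^ (-(d / 2 : ℝ)) * Real.exp (-(Real.pi / t * ‖x‖ ^ 2))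

lemma gaussMul_pos (t : ℝ) (ξ : E d) : 0 < gaussMul t ξ := Real.exp_pos _

lemma gaussMul_le_one {t : ℝ} (ht : 0 ≤ t) (ξ : E d) : gaussMul t ξ ≤ 1 := by
  unfold gaussMul
  have := Real.pi_pos
  rw [Real.exp_le_one_iff]
  have : 0 ≤ Real.pi * t * ‖ξ‖ ^ 2 := by positivity
  linarith

lemma gaussMul_add (s t : ℝ) (ξ : E d) : gaussMul (s + t) ξ = gaussMul s ξ * gaussMul t ξ := by
  unfold gaussMul; rw [← Real.exp_add]; congr 1; ring

lemma gaussMul_zero (ξ : E d) : gaussMul 0 ξ = 1 := by simp [gaussMul]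

lemma gaussMul_natCast_mul (n : ℕ) (t : ℝ) (ξ : E d) :
    gaussMul (n * t) ξ = gaussMul t ξ ^ n := by
  unfold gaussMul; rw [← Real.exp_nat_mul]; congr 1; ring

@[fun_prop]
lemma continuous_gaussMul (t : ℝ) : Continuous (gaussMul t : E d → ℝ) := by
  unfold gaussMul; fun_prop

@[fun_prop]
lemma continuous_gaussKer (t : ℝ) : Continuous (gaussKer t : E d → ℝ) := by
  unfold gaussKer; fun_prop

lemma gaussKer_nonneg {t : ℝ} (ht : 0 < t) (x : E d) : 0 ≤ gaussKer t x := by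
  unfold gaussKer; positivity

lemma integrable_exp_neg_mul_sq {c : ℝ} (hc : 0 < c) :
    Integrable fun x : E d => Real.exp (-(c * ‖x‖ ^ 2)) := by
  have := GaussianFourier.integrable_cexp_neg_mul_sq_norm_add (V := E d) (b := (c : ℂ))
    (by simpa using hc) 0 0
  have h2 := this.norm
  refine h2.congr (Filter.Eventually.of_forall fun x => ?_)
  simp only [Complex.norm_exp]
  congr 1
  simp [← Complex.ofReal_pow, ← Complex.ofReal_mul]

lemma integrable_gaussMul {t : ℝ} (ht : 0 < t) : Integrable (gaussMul t : E d → ℝ) :=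
  integrable_exp_neg_mul_sq (mul_pos Real.pi_pos ht)

lemma integrable_gaussKer {t : ℝ} (ht : 0 < t) : Integrable (gaussKer t : E d → ℝ) :=
  (integrable_exp_neg_mul_sq (div_pos Real.pi_pos ht)).const_mul _

lemma integral_phase_mul_exp {c : ℝ} (hc : 0 < c) (ξ : E d) :
    ∫ x : E d, phase x ξ * (Real.exp (-(c * ‖x‖ ^ 2)) : ℂ) =
      (((Real.pi / c) ^ (d / 2 : ℝ) * Real.exp (-(Real.pi ^ 2 / c * ‖ξ‖ ^ 2)) : ℝ) : ℂ) := by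
  have h := fourier_gaussian_innerProductSpace (V := E d) (b := (c : ℂ)) (by simpa using hc) ξ
  rw [Real.fourier_eq'] at h
  convert! h using 1
  · congr 1; ext x
    unfold phase
    simp only [smul_eq_mul]
    congr 1
    · congr 1; push_cast; ring
    · push_cast; congr 1; ring
  · push_cast
    rw [Complex.ofReal_cpow (by have := Real.pi_pos; positivity)]
    congr 1
    · simp
    · congr 1; ring

lemma integral_phase_mul_gaussMul {t : ℝ} (ht : 0 < t) (ξ : E d) :
    ∫ x : E d, phase x ξ * (gaussMul t x : ℂ) = (gaussKer t ξ : ℂ) := by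
  have hpi := Real.pi_pos
  unfold gaussMul
  rw [integral_phase_mul_exp (mul_pos hpi ht)]
  congr 1
  unfold gaussKer
  congr 1
  · rw [Real.rpow_neg ht.le, ← Real.inv_rpow ht.le]; congr 1; field_simp
  · congr 2; field_simp

lemma integral_phase_mul_gaussKer {t : ℝ} (ht : 0 < t) (ξ : E d) :
    ∫ x : E d, phase x ξ * (gaussKer t x : ℂ) = (gaussMul t ξ : ℂ) := by
  have hpi := Real.pi_pos
  have h := integral_phase_mul_exp (d := d) (div_pos hpi ht) ξ
  have e : ∀ x : E d, phase x ξ * (gaussKer t x : ℂ) =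
      ((t ^ (-(d / 2 : ℝ)) : ℝ) : ℂ) * (phase x ξ * (Real.exp (-(Real.pi / t * ‖x‖ ^ 2)) : ℂ)) := by
    intro x; unfold gaussKer; push_cast; ring
  simp_rw [e]
  rw [integral_const_mul, h, ← Complex.ofReal_mul]
  congr 1
  unfold gaussMul
  rw [← mul_assoc, show Real.pi / (Real.pi / t) = t by field_simp, ← Real.rpow_add ht]
  simp only [neg_add_cancel, Real.rpow_zero, one_mul]
  congr 2; field_simp

lemma integral_gaussKer {t : ℝ} (ht : 0 < t) : ∫ x : E d, gaussKer t x = 1 := by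
  have h := integral_phase_mul_gaussKer (d := d) ht 0
  have : ∀ x : E d, phase x 0 = 1 := by intro x; simp [phase]
  simp only [this, one_mul, gaussMul, norm_zero] at h
  rw [integral_complex_ofReal] at h
  simpa using h

/-! ### Measures smoothed by Gaussians -/

/-- The density of `μ` convolved with the Gaussian kernel. -/
def gaussDensity (μ : Measure (E d)) (t : ℝ) (w : E d) : ℝ := ∫ z, gaussKer t (w - z) ∂μ

lemma gaussDensity_nonneg (μ : Measure (E d)) {t : ℝ} (ht : 0 < t) (w : E d) :
    0 ≤ gaussDensity μ t w :=
  integral_nonneg fun _ => gaussKer_nonneg ht _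

lemma norm_fourierMeasure_le_one (μ : Measure (E d)) [IsProbabilityMeasure μ] (ξ : E d) :
    ‖fourierMeasure μ ξ‖ ≤ 1 := by
  rw [fourierMeasure_eq]
  refine (norm_integral_le_integral_norm _).trans ?_
  simp [norm_phase]

lemma continuous_fourierMeasure (μ : Measure (E d)) [IsProbabilityMeasure μ] :
    Continuous (fourierMeasure μ) := by
  have : fourierMeasure μ = fun ξ => ∫ x, phase x ξ ∂μ := rfl
  rw [this]
  refine continuous_of_dominated (bound := fun _ => 1) ?_ ?_ (integrable_const _) ?_
  · intro ξ
    exact (show Continuous fun x : E d => phase x ξ by fun_prop).aestronglyMeasurable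
  · intro ξ; exact Filter.Eventually.of_forall fun x => (norm_phase x ξ).le
  · exact Filter.Eventually.of_forall fun x =>
      show Continuous fun ξ : E d => phase x ξ by fun_prop

lemma fourierMeasure_neg (μ : Measure (E d)) (ξ : E d) :
    fourierMeasure μ (-ξ) = (starRingEnd ℂ) (fourierMeasure μ ξ) := by
  simp only [fourierMeasure_eq, ← integral_conj, conj_phase]

lemma integrable_gaussKer_sub_prod (μ : Measure (E d)) [IsProbabilityMeasure μ] {t : ℝ}
    (ht : 0 < t) :
    Integrable (fun p : E d × E d => gaussKer t (p.1 - p.2)) (volume.prod μ) := by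
  have hc : Continuous fun p : E d × E d => gaussKer t (p.1 - p.2) :=
    (continuous_gaussKer t).comp (by fun_prop)
  rw [integrable_prod_iff' hc.aestronglyMeasurable]
  constructor
  · exact Filter.Eventually.of_forall fun z => (integrable_gaussKer ht).comp_sub_right z
  · have : ∀ z : E d, ∫ w : E d, ‖gaussKer t (w - z)‖ = 1 := by
      intro z
      simp_rw [Real.norm_of_nonneg (gaussKer_nonneg ht _)]
      rw [integral_sub_right_eq_self (fun w : E d => gaussKer t w), integral_gaussKer ht]
    simp only [this]
    exact integrable_const _

lemma integrable_gaussDensity (μ : Measure (E d)) [IsProbabilityMeasure μ] {t : ℝ} (ht : 0 < t) :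
    Integrable (gaussDensity μ t) :=
  (integrable_gaussKer_sub_prod μ ht).integral_prod_left

lemma integral_phase_mul_gaussDensity (μ : Measure (E d)) [IsProbabilityMeasure μ] {t : ℝ}
    (ht : 0 < t) (ξ : E d) :
    ∫ w : E d, phase w ξ * (gaussDensity μ t w : ℂ) = fourierMeasure μ ξ * gaussMul t ξ := by
  have h1 : ∀ w : E d, phase w ξ * (gaussDensity μ t w : ℂ) =
      ∫ z, phase w ξ * (gaussKer t (w - z) : ℂ) ∂μ := by
    intro w
    rw [integral_const_mul, gaussDensity, integral_complex_ofReal]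
  simp_rw [h1]
  rw [integral_integral_swap]
  · rw [fourierMeasure_eq, ← integral_mul_const]
    congr 1; ext z
    rw [← integral_phase_mul_gaussKer ht, ← integral_const_mul,
      ← integral_sub_right_eq_self (fun w : E d => phase z ξ * (phase w ξ * (gaussKer t w : ℂ))) z]
    congr 1; ext w
    rw [← mul_assoc, ← phase_add_left, add_sub_cancel]
  · have := (integrable_gaussKer_sub_prod μ ht).ofReal (𝕜 := ℂ)
    refine this.bdd_mul (c := 1) ?_ ?_
    · exact (show Continuous fun p : E d × E d => phase p.1 ξ by fun_prop).aestronglyMeasurable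
    · exact Filter.Eventually.of_forall fun p => (norm_phase _ _).le

/-- The ball condition extends to all radii. -/
lemma BallCondition.le_of_pos {μ : Measure (E d)} [IsProbabilityMeasure μ] {a A : ℝ}
    (h : BallCondition μ a A) (ha : 0 < a) (hA : 1 ≤ A) (x : E d) {r : ℝ} (hr : 0 < r) :
    μ (Metric.ball x r) ≤ ENNReal.ofReal (A * r ^ a) := by
  rcases le_or_gt r 1 with h1 | h1
  · exact h x r hr h1
  · refine prob_le_one.trans ?_
    rw [← ENNReal.ofReal_one]
    refine ENNReal.ofReal_le_ofReal ?_
    have := Real.one_le_rpow h1.le ha.le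
    nlinarith

/-- The constant in the pointwise bound for `gaussDensity`. -/
def gaussConst (a : ℝ) : ℝ := ∑' n : ℕ, Real.exp (-n) * ((n : ℝ) + 1) ^ a

lemma summable_exp_neg_mul_rpow (a : ℝ) :
    Summable fun n : ℕ => Real.exp (-n) * ((n : ℝ) + 1) ^ a := by
  have h := Real.summable_pow_mul_exp_neg_nat_mul ⌈a⌉₊ (r := 1) one_pos
  have h2 := (summable_nat_add_iff 1).2 h
  have h3 := h2.mul_left (Real.exp 1)
  refine Summable.of_nonneg_of_le (fun n => by positivity) (fun n => ?_) h3
  have e : Real.exp 1 * (((n + 1 : ℕ) : ℝ) ^ ⌈a⌉₊ * Real.exp (-1 * ((n + 1 : ℕ) : ℝ))) =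
      Real.exp (-n) * ((n : ℝ) + 1) ^ ⌈a⌉₊ := by
    rw [show (-(n : ℝ)) = 1 + (-1 * ((n + 1 : ℕ) : ℝ)) by push_cast; ring, Real.exp_add]
    push_cast; ring
  rw [e]
  gcongr
  rw [← Real.rpow_natCast]
  exact Real.rpow_le_rpow_of_exponent_le (by simp) (Nat.le_ceil a)

lemma gaussConst_nonneg (a : ℝ) : 0 ≤ gaussConst a := tsum_nonneg fun n => by positivity

/-- At distance between `n√t` and `(n+1)√t` the kernel is at most `t^{-d/2} e^{-n}`, while the ball
of radius `(n+1)√t` has measure at most `A ((n+1)√t)^a`. Summing over `n` produces `gaussConst a`.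
-/
lemma gaussDensity_le {μ : Measure (E d)} [IsProbabilityMeasure μ] {a A : ℝ}
    (h : BallCondition μ a A) (ha : 0 < a) (hA : 1 ≤ A) {t : ℝ} (ht : 0 < t) (w : E d) :
    gaussDensity μ t w ≤ gaussConst a * A * t ^ (-((d - a) / 2)) := by
  have hpi := Real.pi_gt_three
  set s := Real.sqrt t with hs
  have hs0 : 0 < s := Real.sqrt_pos.2 ht
  have hs2 : s ^ 2 = t := Real.sq_sqrt ht.le
  have key : ∫⁻ z, ENNReal.ofReal (gaussKer t (w - z)) ∂μ ≤
      ENNReal.ofReal (gaussConst a * A * t ^ (-((d - a) / 2))) := by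
    calc ∫⁻ z, ENNReal.ofReal (gaussKer t (w - z)) ∂μ
        ≤ ∫⁻ z, ∑' n : ℕ, (Metric.ball w ((n + 1) * s)).indicator
            (fun _ => ENNReal.ofReal (t ^ (-(d / 2 : ℝ)) * Real.exp (-n))) z ∂μ := by
          refine lintegral_mono fun z => ?_
          -- A single term of the series, the one for the shell containing `z`, already dominates
          -- the kernel.
          set n := ⌊‖w - z‖ / s⌋₊ with hn
          refine le_trans ?_ (ENNReal.le_tsum n)
          have h1 : (n : ℝ) ≤ ‖w - z‖ / s := Nat.floor_le (by positivity)
          have h2 : ‖w - z‖ / s < n + 1 := Nat.lt_floor_add_one _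
          rw [Set.indicator_of_mem]
          · refine ENNReal.ofReal_le_ofReal ?_
            unfold gaussKer
            gcongr
            rw [le_div_iff₀ hs0] at h1
            have h3 : (n : ℝ) ^ 2 * t ≤ ‖w - z‖ ^ 2 := by
              rw [← hs2, ← mul_pow]; gcongr
            have h4 : (n : ℝ) ^ 2 ≤ ‖w - z‖ ^ 2 / t := by rwa [le_div_iff₀ ht]
            have h5 : (n : ℝ) ≤ (n : ℝ) ^ 2 := by
              exact_mod_cast Nat.le_self_pow two_ne_zero n
            have h6 : Real.pi / t * ‖w - z‖ ^ 2 = Real.pi * (‖w - z‖ ^ 2 / t) := by ring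
            rw [h6]
            nlinarith
          · rw [Metric.mem_ball, dist_comm, dist_eq_norm]
            rwa [div_lt_iff₀ hs0] at h2
      _ = ∑' n : ℕ, ENNReal.ofReal (t ^ (-(d / 2 : ℝ)) * Real.exp (-n)) *
            μ (Metric.ball w ((n + 1) * s)) := by
          rw [lintegral_tsum]
          · congr 1; ext n
            rw [lintegral_indicator_const Metric.isOpen_ball.measurableSet]
          · intro n
            exact (measurable_const.indicator Metric.isOpen_ball.measurableSet).aemeasurable
      _ ≤ ∑' n : ℕ, ENNReal.ofReal
            (A * t ^ (-((d - a) / 2)) * (Real.exp (-n) * ((n : ℝ) + 1) ^ a)) := by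
          refine ENNReal.tsum_le_tsum fun n => ?_
          refine (mul_le_mul_right (h.le_of_pos ha hA w (by positivity)) _).trans ?_
          rw [← ENNReal.ofReal_mul (by positivity)]
          refine ENNReal.ofReal_le_ofReal (le_of_eq ?_)
          rw [Real.mul_rpow (by positivity) hs0.le, hs, Real.sqrt_eq_rpow, ← Real.rpow_mul ht.le]
          have : t ^ (-((d - a) / 2)) = t ^ (-(d / 2 : ℝ)) * t ^ (1 / 2 * a) := by
            rw [← Real.rpow_add ht]; congr 1; ring
          rw [this]; ring
      _ = ENNReal.ofReal (gaussConst a * A * t ^ (-((d - a) / 2))) := by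
          rw [← ENNReal.ofReal_tsum_of_nonneg (fun n => by positivity)
            ((summable_exp_neg_mul_rpow a).mul_left _), tsum_mul_left]
          congr 1; unfold gaussConst; ring
  unfold gaussDensity
  rw [integral_eq_lintegral_of_nonneg_ae
    (Filter.Eventually.of_forall fun z => gaussKer_nonneg ht _)
    ((continuous_gaussKer t).comp (by fun_prop)).aestronglyMeasurable]
  refine ENNReal.toReal_le_of_le_ofReal ?_ key
  have := gaussConst_nonneg a
  positivity

/-! ### The bilinear form, Fourier integrals and Bessel's inequality. -/

/-- Integrable functions bounded by `1`. -/
structure UnitFun (f : E d → ℂ) : Prop where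
  integrable : Integrable f
  norm_le : ∀ x, ‖f x‖ ≤ 1

lemma UnitFun.conj {f : E d → ℂ} (hf : UnitFun f) : UnitFun fun x => (starRingEnd ℂ) (f x) where
  integrable := by
    refine hf.integrable.mono ?_ (Filter.Eventually.of_forall fun x => by simp)
    exact Complex.continuous_conj.comp_aestronglyMeasurable hf.integrable.aestronglyMeasurable
  norm_le x := by simpa using hf.norm_le x

/-- The `L¹` norm. -/
def mass (f : E d → ℂ) : ℝ := ∫ x, ‖f x‖

lemma mass_nonneg (f : E d → ℂ) : 0 ≤ mass f := integral_nonneg fun _ => norm_nonneg _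

lemma mass_conj (f : E d → ℂ) : mass (fun x => (starRingEnd ℂ) (f x)) = mass f := by
  simp [mass]

/-- The bilinear form `∬ f(y) g(x) k(x - y) dy dx`. -/
def form (k f g : E d → ℂ) : ℂ :=
  ∫ p : E d × E d, f p.1 * g p.2 * k (p.2 - p.1) ∂(volume.prod volume)

lemma integrable_form {k f g : E d → ℂ} (hk : Continuous k) {c : ℝ} (hkc : ∀ x, ‖k x‖ ≤ c)
    (hf : Integrable f) (hg : Integrable g) :
    Integrable (fun p : E d × E d => f p.1 * g p.2 * k (p.2 - p.1)) (volume.prod volume) :=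
  (hf.mul_prod hg).mul_bdd (c := c)
    (hk.comp (by fun_prop : Continuous fun p : E d × E d => p.2 - p.1)).aestronglyMeasurable
    (Filter.Eventually.of_forall fun _ => hkc _)

lemma norm_form_le {k f g : E d → ℂ} {c : ℝ} (hkc : ∀ x, ‖k x‖ ≤ c)
    (hf : Integrable f) (hg : Integrable g) :
    ‖form k f g‖ ≤ c * (mass f * mass g) := by
  unfold form mass
  rw [← integral_prod_mul, ← integral_const_mul]
  refine norm_integral_le_of_norm_le ((hf.norm.mul_prod hg.norm).const_mul c)
    (Filter.Eventually.of_forall fun p => ?_)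
  simp only [norm_mul]
  rw [mul_comm c]
  exact mul_le_mul_of_nonneg_left (hkc _) (by positivity)

/-- Hermitian symmetry of the kernel exchanges the roles of `f` and `g`, so an asymmetric estimate
comes with its dual. -/
lemma form_swap_conj {k : E d → ℂ} (hk : ∀ x, k (-x) = (starRingEnd ℂ) (k x)) (f g : E d → ℂ) :
    form k f g = (starRingEnd ℂ)
      (form k (fun x => (starRingEnd ℂ) (g x)) (fun x => (starRingEnd ℂ) (f x))) := by
  unfold form
  rw [← integral_conj, ← integral_prod_swap]
  congr 1; ext p
  simp only [Prod.fst_swap, Prod.snd_swap, map_mul, Complex.conj_conj]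
  rw [← neg_sub, hk]; ring

/-- The Fourier integral `∫ f(y) e^{-2πi⟨y,w⟩} dy`. -/
def fourierInt (f : E d → ℂ) (w : E d) : ℂ := ∫ y, f y * phase y w

lemma continuous_fourierInt {f : E d → ℂ} (hf : Integrable f) : Continuous (fourierInt f) := by
  refine continuous_of_dominated (bound := fun y => ‖f y‖) ?_ ?_ hf.norm ?_
  · intro ξ
    exact hf.aestronglyMeasurable.mul
      (show Continuous fun x : E d => phase x ξ by fun_prop).aestronglyMeasurable
  · intro ξ; exact Filter.Eventually.of_forall fun x => by simp [norm_phase]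
  · exact Filter.Eventually.of_forall fun x =>
      continuous_const.mul (show Continuous fun ξ : E d => phase x ξ by fun_prop)

lemma norm_fourierInt_le (f : E d → ℂ) (w : E d) : ‖fourierInt f w‖ ≤ mass f := by
  refine (norm_integral_le_integral_norm _).trans ?_
  simp [norm_phase, mass]

lemma fourierInt_conj (f : E d → ℂ) (w : E d) :
    fourierInt (fun x => (starRingEnd ℂ) (f x)) w = (starRingEnd ℂ) (fourierInt f (-w)) := by
  unfold fourierInt
  rw [← integral_conj]
  congr 1; ext y
  simp [conj_phase]

/-- The character at `x - y` factors into one in `x` and one in `y`, so Fubini diagonalises the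
form: `h` becomes a weight against the two Fourier integrals. -/
lemma form_eq_integral_fourierInt {f g : E d → ℂ} {h : E d → ℝ} {k : E d → ℂ}
    (hf : Integrable f) (hg : Integrable g) (hh : Integrable h)
    (hk : ∀ ξ, k ξ = ∫ w : E d, phase w ξ * (h w : ℂ)) :
    form k f g = ∫ w : E d, (h w : ℂ) * (fourierInt f (-w) * fourierInt g w) := by
  have h1 : form k f g = ∫ p : E d × E d, (∫ w : E d,
      f p.1 * g p.2 * (phase w (p.2 - p.1) * (h w : ℂ))) ∂(volume.prod volume) := by
    unfold form
    congr 1; ext p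
    rw [hk, integral_const_mul]
  rw [h1, integral_integral_swap]
  · congr 1; ext w
    unfold fourierInt
    rw [← integral_prod_mul, ← integral_const_mul]
    congr 1; ext p
    rw [sub_eq_add_neg, phase_add_right, phase_comm w p.2, phase_comm w (-p.1), phase_neg_left]
    ring
  · have h2 := (hf.mul_prod hg).mul_prod (hh.ofReal (𝕜 := ℂ))
    have h3 := h2.bdd_mul (c := 1)
      (f := fun q : (E d × E d) × E d => phase q.2 (q.1.2 - q.1.1))
      (continuous_phase.comp (by fun_prop : Continuous fun q : (E d × E d) × E d =>
        (q.2, q.1.2 - q.1.1))).aestronglyMeasurable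
      (Filter.Eventually.of_forall fun q => (norm_phase _ _).le)
    refine h3.congr (Filter.Eventually.of_forall fun q => ?_)
    simp only [Function.uncurry, RCLike.ofReal_eq_complex_ofReal]
    ring

lemma normSq_fourierInt_eq (f : E d → ℂ) (w : E d) :
    fourierInt (fun x => (starRingEnd ℂ) (f x)) (-w) * fourierInt f w =
      ((‖fourierInt f w‖ ^ 2 : ℝ) : ℂ) := by
  rw [fourierInt_conj, neg_neg, Complex.conj_mul']
  push_cast; rfl

/-- The left side is the form of `gaussKer t` at `(f̄, f)`. One factor is bounded by `1` and the
kernel has integral `1`, which leaves the `L¹` norm of the other factor. -/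
lemma integral_gaussMul_mul_normSq_le {f : E d → ℂ} (hf : UnitFun f) {t : ℝ} (ht : 0 < t) :
    ∫ w : E d, gaussMul t w * ‖fourierInt f w‖ ^ 2 ≤ mass f := by
  have h1 := form_eq_integral_fourierInt hf.conj.integrable hf.integrable
    (integrable_gaussMul (d := d) ht) (k := fun x => (gaussKer t x : ℂ))
    (fun ξ => (integral_phase_mul_gaussMul ht ξ).symm)
  simp_rw [normSq_fourierInt_eq, ← Complex.ofReal_mul] at h1
  rw [integral_complex_ofReal] at h1
  have h2 : ‖form (fun x => (gaussKer t x : ℂ)) (fun x => (starRingEnd ℂ) (f x)) f‖ ≤ mass f := by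
    unfold form
    have hi : Integrable (fun p : E d × E d => ‖f p.1‖ * gaussKer t (p.2 - p.1))
        (volume.prod volume) := by
      have hm : AEStronglyMeasurable (fun p : E d × E d => ‖f p.1‖ * gaussKer t (p.2 - p.1))
          (volume.prod volume) :=
        hf.integrable.norm.aestronglyMeasurable.comp_fst.mul
          ((continuous_gaussKer t).comp
            (by fun_prop : Continuous fun p : E d × E d => p.2 - p.1)).aestronglyMeasurable
      rw [integrable_prod_iff hm]
      constructor
      · exact Filter.Eventually.of_forall fun z =>
          ((integrable_gaussKer ht).comp_sub_right z).const_mul ‖f z‖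
      · have : ∀ x : E d, ∫ w : E d, ‖‖f x‖ * gaussKer t (w - x)‖ = ‖f x‖ := by
          intro z
          simp_rw [norm_mul, Real.norm_of_nonneg (gaussKer_nonneg ht _), norm_norm]
          rw [integral_const_mul, integral_sub_right_eq_self (fun w : E d => gaussKer t w),
            integral_gaussKer ht, mul_one]
        simp only [this]
        exact hf.integrable.norm
    refine (norm_integral_le_of_norm_le hi (Filter.Eventually.of_forall fun p => ?_)).trans ?_
    · simp only [norm_mul, RCLike.norm_conj, Complex.norm_real,
        Real.norm_of_nonneg (gaussKer_nonneg ht _)]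
      have := hf.norm_le p.2
      have := gaussKer_nonneg ht (p.2 - p.1)
      exact mul_le_mul_of_nonneg_right (mul_le_of_le_one_right (norm_nonneg _) (hf.norm_le _)) this
    · rw [integral_prod _ hi]
      refine le_of_eq ?_
      unfold mass
      congr 1; ext z
      simp only
      rw [integral_const_mul, integral_sub_right_eq_self (fun w : E d => gaussKer t w),
            integral_gaussKer ht, mul_one]
  rw [h1, Complex.norm_real] at h2
  exact (le_abs_self _).trans h2

/-- Fatou's lemma as the Gaussian weight tends to `1`. -/
lemma lintegral_normSq_fourierInt_le {f : E d → ℂ} (hf : UnitFun f) :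
    ∫⁻ w : E d, ENNReal.ofReal (‖fourierInt f w‖ ^ 2) ≤ ENNReal.ofReal (mass f) := by
  have hc := continuous_fourierInt hf.integrable
  have hlim : ∀ w : E d, Filter.Tendsto
      (fun n : ℕ => ENNReal.ofReal (gaussMul (1 / ((n : ℝ) + 1)) w * ‖fourierInt f w‖ ^ 2))
      Filter.atTop (nhds (ENNReal.ofReal (‖fourierInt f w‖ ^ 2))) := by
    intro w
    refine ENNReal.tendsto_ofReal ?_
    have h1 : Continuous fun t : ℝ => gaussMul t w * ‖fourierInt f w‖ ^ 2 := by
      unfold gaussMul; fun_prop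
    have h2 := (h1.tendsto 0).comp (tendsto_one_div_add_atTop_nhds_zero_nat (𝕜 := ℝ))
    simpa only [gaussMul_zero, one_mul, Function.comp_def] using h2
  have hb : ∀ n : ℕ, ∫⁻ w : E d,
      ENNReal.ofReal (gaussMul (1 / ((n : ℝ) + 1)) w * ‖fourierInt f w‖ ^ 2) ≤
      ENNReal.ofReal (mass f) := by
    intro n
    have ht : (0 : ℝ) < 1 / ((n : ℝ) + 1) := by positivity
    rw [← ofReal_integral_eq_lintegral_ofReal]
    · exact ENNReal.ofReal_le_ofReal (integral_gaussMul_mul_normSq_le hf ht)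
    · refine (integrable_gaussMul ht).mul_bdd (c := mass f ^ 2)
        (hc.norm.pow 2).aestronglyMeasurable (Filter.Eventually.of_forall fun w => ?_)
      rw [norm_pow, norm_norm]
      gcongr
      exact norm_fourierInt_le f w
    · exact Filter.Eventually.of_forall fun w => by
        have := gaussMul_pos (1 / ((n : ℝ) + 1)) w
        simp only [Pi.zero_apply]; positivity
  calc ∫⁻ w : E d, ENNReal.ofReal (‖fourierInt f w‖ ^ 2)
      = ∫⁻ w : E d, Filter.liminf (fun n : ℕ =>
          ENNReal.ofReal (gaussMul (1 / ((n : ℝ) + 1)) w * ‖fourierInt f w‖ ^ 2))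
          Filter.atTop := by
        congr 1; ext w; exact (hlim w).liminf_eq.symm
    _ ≤ Filter.liminf (fun n : ℕ => ∫⁻ w : E d,
          ENNReal.ofReal (gaussMul (1 / ((n : ℝ) + 1)) w * ‖fourierInt f w‖ ^ 2))
          Filter.atTop := by
        refine lintegral_liminf_le fun n => ?_
        exact (ENNReal.continuous_ofReal.comp
          ((continuous_gaussMul _).mul (hc.norm.pow 2))).measurable
    _ ≤ ENNReal.ofReal (mass f) := by
        refine Filter.liminf_le_of_frequently_le' ?_
        exact Filter.Frequently.of_forall hb

lemma integrable_normSq_fourierInt {f : E d → ℂ} (hf : UnitFun f) :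
    Integrable fun w : E d => ‖fourierInt f w‖ ^ 2 := by
  have hc := continuous_fourierInt hf.integrable
  refine ⟨(hc.norm.pow 2).aestronglyMeasurable, ?_⟩
  rw [hasFiniteIntegral_iff_ofReal (Filter.Eventually.of_forall fun w => by
    simp only [Pi.zero_apply]; positivity)]
  exact (lintegral_normSq_fourierInt_le hf).trans_lt ENNReal.ofReal_lt_top

/-- Bessel's inequality for functions bounded by `1`. -/
lemma integral_normSq_fourierInt_le {f : E d → ℂ} (hf : UnitFun f) :
    ∫ w : E d, ‖fourierInt f w‖ ^ 2 ≤ mass f := by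
  have hc := continuous_fourierInt hf.integrable
  rw [integral_eq_lintegral_of_nonneg_ae (Filter.Eventually.of_forall fun w => by
    simp only [Pi.zero_apply]; positivity) (integrable_normSq_fourierInt hf).aestronglyMeasurable]
  exact ENNReal.toReal_le_of_le_ofReal (mass_nonneg f) (lintegral_normSq_fourierInt_le hf)

lemma sq_integral_mul_le {α : Type*} [MeasurableSpace α] {μ : Measure α} {u v : α → ℝ}
    (hu : AEStronglyMeasurable u μ) (hv : AEStronglyMeasurable v μ)
    (hu0 : ∀ x, 0 ≤ u x) (hv0 : ∀ x, 0 ≤ v x)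
    (hu2 : Integrable (fun x => u x ^ 2) μ) (hv2 : Integrable (fun x => v x ^ 2) μ) :
    (∫ x, u x * v x ∂μ) ^ 2 ≤ (∫ x, u x ^ 2 ∂μ) * ∫ x, v x ^ 2 ∂μ := by
  have h := integral_mul_le_Lp_mul_Lq_of_nonneg (μ := μ) (f := u) (g := v)
    (p := 2) (q := 2) (by constructor <;> norm_num)
    (Filter.Eventually.of_forall hu0) (Filter.Eventually.of_forall hv0)
    (by simpa using (memLp_two_iff_integrable_sq hu).2 hu2)
    (by simpa using (memLp_two_iff_integrable_sq hv).2 hv2)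
  simp only [Real.rpow_two, ← Real.sqrt_eq_rpow] at h
  have h0 : 0 ≤ ∫ x, u x * v x ∂μ := integral_nonneg fun x => mul_nonneg (hu0 x) (hv0 x)
  refine (pow_le_pow_left₀ h0 h 2).trans ?_
  rw [mul_pow, Real.sq_sqrt (integral_nonneg fun x => sq_nonneg _),
    Real.sq_sqrt (integral_nonneg fun x => sq_nonneg _)]

/-! ### Damped kernels and the `T T^*` inequality. -/

/-- The kernel `μ̂` damped by a Gaussian. -/
def dampedKer (μ : Measure (E d)) (t : ℝ) (ξ : E d) : ℂ := fourierMeasure μ ξ * gaussMul t ξ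

lemma dampedKer_zero (μ : Measure (E d)) : dampedKer μ 0 = fourierMeasure μ := by
  ext ξ; simp [dampedKer, gaussMul_zero]

lemma continuous_dampedKer (μ : Measure (E d)) [IsProbabilityMeasure μ] (t : ℝ) :
    Continuous (dampedKer μ t) := by
  have := continuous_fourierMeasure μ
  unfold dampedKer; fun_prop

lemma norm_dampedKer_le (μ : Measure (E d)) {t : ℝ} (ht : 0 ≤ t) (ξ : E d) :
    ‖dampedKer μ t ξ‖ ≤ ‖fourierMeasure μ ξ‖ := by
  unfold dampedKer
  rw [norm_mul, Complex.norm_real, Real.norm_of_nonneg (gaussMul_pos _ _).le]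
  exact mul_le_of_le_one_right (norm_nonneg _) (gaussMul_le_one ht ξ)

section

variable {μ : Measure (E d)} [IsProbabilityMeasure μ] {t S : ℝ} {f g : E d → ℂ}

/-- On the diagonal the form is a positive quadratic form: the weight is the density of a smoothed
positive measure. The `T T^*` inequality uses this to recognise a Cauchy–Schwarz factor as a value
of the form. -/
lemma norm_form_dampedKer_conj_eq (ht : 0 < t) (hf : UnitFun f) :
    ‖form (dampedKer μ t) f (fun x => (starRingEnd ℂ) (f x))‖ =
      ∫ w : E d, gaussDensity μ t w * ‖fourierInt f (-w)‖ ^ 2 := by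
  rw [form_eq_integral_fourierInt (k := dampedKer μ t) hf.integrable hf.conj.integrable (integrable_gaussDensity μ ht)
    (fun ξ => (integral_phase_mul_gaussDensity μ ht ξ).symm)]
  simp_rw [fourierInt_conj, Complex.mul_conj', ← Complex.ofReal_pow, ← Complex.ofReal_mul]
  rw [integral_complex_ofReal, Complex.norm_real, Real.norm_of_nonneg]
  exact integral_nonneg fun w => mul_nonneg (gaussDensity_nonneg μ ht w) (sq_nonneg _)

lemma norm_form_dampedKer_conj_le (ht : 0 < t) (hf : UnitFun f)
    (hS : ∀ w, gaussDensity μ t w ≤ S) :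
    ‖form (dampedKer μ t) f (fun x => (starRingEnd ℂ) (f x))‖ ≤ S * mass f := by
  rw [norm_form_dampedKer_conj_eq ht hf]
  have hS0 : 0 ≤ S := (gaussDensity_nonneg μ ht 0).trans (hS 0)
  have hi := (integrable_normSq_fourierInt hf).comp_neg
  calc ∫ w : E d, gaussDensity μ t w * ‖fourierInt f (-w)‖ ^ 2
      ≤ ∫ w : E d, S * ‖fourierInt f (-w)‖ ^ 2 := by
        refine integral_mono_of_nonneg (Filter.Eventually.of_forall fun w =>
          mul_nonneg (gaussDensity_nonneg μ ht w) (sq_nonneg _)) (hi.const_mul S)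
          (Filter.Eventually.of_forall fun w => ?_)
        exact mul_le_mul_of_nonneg_right (hS w) (sq_nonneg _)
    _ ≤ S * mass f := by
        rw [integral_const_mul, integral_neg_eq_self (fun w : E d => ‖fourierInt f w‖ ^ 2)]
        exact mul_le_mul_of_nonneg_left (integral_normSq_fourierInt_le hf) hS0

/-- The `T T^*` inequality. -/
lemma sq_norm_form_dampedKer_le (ht : 0 < t) (hf : UnitFun f) (hg : UnitFun g)
    (hS : ∀ w, gaussDensity μ t w ≤ S) :
    ‖form (dampedKer μ t) f g‖ ^ 2 ≤
      S * ‖form (dampedKer μ t) f (fun x => (starRingEnd ℂ) (f x))‖ * mass g := by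
  have hS0 : 0 ≤ S := (gaussDensity_nonneg μ ht 0).trans (hS 0)
  have hD := integrable_gaussDensity μ ht
  have hD0 := gaussDensity_nonneg μ ht
  have hcf : Continuous fun w => fourierInt f (-w) :=
    (continuous_fourierInt hf.integrable).comp continuous_neg
  have hcg := continuous_fourierInt hg.integrable
  have hif : Integrable fun w : E d => gaussDensity μ t w * ‖fourierInt f (-w)‖ ^ 2 := by
    refine hD.mul_bdd (c := mass f ^ 2)
        (hcf.norm.pow 2).aestronglyMeasurable (Filter.Eventually.of_forall fun w => ?_)
    rw [norm_pow, norm_norm]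
    gcongr
    exact norm_fourierInt_le f _
  -- Only one of the two copies of the density is replaced by its supremum; the other remains as the
  -- weight that reproduces the diagonal form.
  have hle : ∀ w, (gaussDensity μ t w * ‖fourierInt f (-w)‖) ^ 2 ≤
      S * (gaussDensity μ t w * ‖fourierInt f (-w)‖ ^ 2) := by
    intro w
    rw [mul_pow, sq (gaussDensity μ t w), mul_assoc]
    exact mul_le_mul_of_nonneg_right (hS w) (mul_nonneg (hD0 w) (sq_nonneg _))
  have hm : AEStronglyMeasurable fun w : E d => gaussDensity μ t w * ‖fourierInt f (-w)‖ :=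
    hD.aestronglyMeasurable.mul hcf.norm.aestronglyMeasurable
  have hi2 : Integrable fun w : E d => (gaussDensity μ t w * ‖fourierInt f (-w)‖) ^ 2 := by
    refine (hif.const_mul S).mono' (hm.pow 2) (Filter.Eventually.of_forall fun w => ?_)
    rw [Real.norm_of_nonneg (sq_nonneg _)]
    exact hle w
  have h1 : ‖form (dampedKer μ t) f g‖ ≤
      ∫ w : E d, (gaussDensity μ t w * ‖fourierInt f (-w)‖) * ‖fourierInt g w‖ := by
    rw [form_eq_integral_fourierInt (k := dampedKer μ t) hf.integrable hg.integrable hD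
      (fun ξ => (integral_phase_mul_gaussDensity μ ht ξ).symm)]
    refine (norm_integral_le_integral_norm _).trans (le_of_eq ?_)
    congr 1; ext w
    rw [norm_mul, norm_mul, Complex.norm_real, Real.norm_of_nonneg (hD0 w), mul_assoc]
  have h2 := sq_integral_mul_le hm hcg.norm.aestronglyMeasurable
    (fun w => mul_nonneg (hD0 w) (norm_nonneg _)) (fun w => norm_nonneg _) hi2
    (integrable_normSq_fourierInt hg)
  refine (pow_le_pow_left₀ (norm_nonneg _) h1 2).trans (h2.trans ?_)
  rw [norm_form_dampedKer_conj_eq ht hf, ← integral_const_mul S]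
  refine mul_le_mul (integral_mono hi2 (hif.const_mul S) hle) (integral_normSq_fourierInt_le hg)
    (integral_nonneg fun _ => sq_nonneg _) ?_
  exact integral_nonneg fun w => mul_nonneg hS0 (mul_nonneg (hD0 w) (sq_nonneg _))

end

/-! ### Splitting the kernel and the restricted bilinear estimates. -/

lemma gaussConst_pos (a : ℝ) : 0 < gaussConst a :=
  (summable_exp_neg_mul_rpow a).tsum_pos (fun n => by positivity) 0 (by simp)

/-- As `d - a > 0`, the bound at time `r` serves all later times, hence every damped kernel that
occurs in the splitting. -/
lemma gaussDensity_le_of_le {μ : Measure (E d)} [IsProbabilityMeasure μ] {a A : ℝ}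
    (h : BallCondition μ a A) (ha : 0 < a) (had : a < d) (hA : 1 ≤ A) {r t : ℝ} (hr : 0 < r)
    (hrt : r ≤ t) (w : E d) :
    gaussDensity μ t w ≤ gaussConst a * A * r ^ (-((d - a) / 2)) := by
  refine (gaussDensity_le h ha hA (hr.trans_le hrt) w).trans ?_
  have := gaussConst_pos a
  refine mul_le_mul_of_nonneg_left ?_ (by positivity)
  exact Real.rpow_le_rpow_of_nonpos hr hrt (by linarith)

lemma FourierDecay.norm_le {μ : Measure (E d)} [IsProbabilityMeasure μ] {b B : ℝ}
    (h : FourierDecay μ b B) (hb : 0 < b) (hB : 1 ≤ B) {ξ : E d} (hξ : ξ ≠ 0) :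
    ‖fourierMeasure μ ξ‖ ≤ B * ‖ξ‖ ^ (-b) := by
  have h0 : 0 < ‖ξ‖ := norm_pos_iff.2 hξ
  have h0b : 0 < ‖ξ‖ ^ b := by positivity
  rw [Real.rpow_neg h0.le, ← div_eq_mul_inv, le_div_iff₀ h0b, mul_comm]
  rcases le_or_gt 1 ‖ξ‖ with h1 | h1
  · exact h ξ h1
  · have := Real.rpow_le_one h0.le h1.le hb.le
    have := norm_fourierMeasure_le_one μ ξ
    nlinarith [norm_nonneg (fourierMeasure μ ξ)]

/-- With `u = r‖ξ‖²`, the factor `1 - e^{-πu}` is at most `min(1, πu)`. Its `N`-th power therefore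
compensates the singularity `u^{-b/2}` at the origin as soon as `N ≥ b/2`; for large `u` the decay
alone suffices. -/
lemma norm_dampedKer_mul_tail_le {μ : Measure (E d)} [IsProbabilityMeasure μ] {b B : ℝ}
    (h : FourierDecay μ b B) (hb : 0 < b) (hB : 1 ≤ B) {r t : ℝ} (hr : 0 < r) (ht : 0 ≤ t)
    {N : ℕ} (hN0 : N ≠ 0) (hN : b / 2 ≤ N) (ξ : E d) :
    ‖dampedKer μ t ξ * ((1 - gaussMul r ξ) ^ N : ℝ)‖ ≤ Real.pi ^ N * B * r ^ (b / 2) := by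
  have hpi := Real.pi_gt_three
  rcases eq_or_ne ξ 0 with rfl | hξ
  · have : gaussMul r (0 : E d) = 1 := by simp [gaussMul]
    rw [this]
    simp only [sub_self, zero_pow hN0, Complex.ofReal_zero, mul_zero, norm_zero]
    positivity
  have h0 : 0 < ‖ξ‖ := norm_pos_iff.2 hξ
  set u := r * ‖ξ‖ ^ 2 with hu
  have hu0 : 0 < u := by positivity
  have g1 : 0 ≤ 1 - gaussMul r ξ := sub_nonneg.2 (gaussMul_le_one hr.le ξ)
  have g2 : 1 - gaussMul r ξ ≤ 1 := by linarith [gaussMul_pos r ξ]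
  have g3 : 1 - gaussMul r ξ ≤ Real.pi * u := by
    unfold gaussMul
    have := Real.add_one_le_exp (-(Real.pi * r * ‖ξ‖ ^ 2))
    rw [hu]; linarith
  have key : u ^ (-(b / 2)) * (1 - gaussMul r ξ) ^ N ≤ Real.pi ^ N := by
    rcases le_or_gt 1 u with h1 | h1
    · have e1 : u ^ (-(b / 2)) ≤ 1 := Real.rpow_le_one_of_one_le_of_nonpos h1 (by linarith)
      have e2 : (1 - gaussMul r ξ) ^ N ≤ 1 := pow_le_one₀ g1 g2
      have e3 : (1 : ℝ) ≤ Real.pi ^ N := one_le_pow₀ (by linarith)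
      have e4 : 0 ≤ u ^ (-(b / 2)) := by positivity
      have e5 : 0 ≤ (1 - gaussMul r ξ) ^ N := by positivity
      nlinarith
    · have e1 : (1 - gaussMul r ξ) ^ N ≤ (Real.pi * u) ^ N := by gcongr
      have e2 : u ^ (-(b / 2)) * u ^ N ≤ 1 := by
        rw [← Real.rpow_natCast, ← Real.rpow_add hu0]
        exact Real.rpow_le_one hu0.le h1.le (by linarith)
      calc u ^ (-(b / 2)) * (1 - gaussMul r ξ) ^ N ≤ u ^ (-(b / 2)) * (Real.pi * u) ^ N := by
            gcongr
        _ = Real.pi ^ N * (u ^ (-(b / 2)) * u ^ N) := by rw [mul_pow]; ring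
        _ ≤ Real.pi ^ N * 1 := by gcongr
        _ = _ := mul_one _
  have e : ‖ξ‖ ^ (-b) = r ^ (b / 2) * u ^ (-(b / 2)) := by
    rw [hu, Real.mul_rpow hr.le (by positivity), ← mul_assoc, ← Real.rpow_add hr]
    rw [← Real.rpow_natCast, ← Real.rpow_mul h0.le]
    rw [add_neg_cancel, Real.rpow_zero, one_mul]
    congr 1; push_cast; ring
  rw [norm_mul, Complex.norm_real, Real.norm_of_nonneg (by positivity)]
  calc ‖dampedKer μ t ξ‖ * (1 - gaussMul r ξ) ^ N
      ≤ (B * ‖ξ‖ ^ (-b)) * (1 - gaussMul r ξ) ^ N := by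
        gcongr
        exact (norm_dampedKer_le μ ht ξ).trans (h.norm_le hb hB hξ)
    _ = B * r ^ (b / 2) * (u ^ (-(b / 2)) * (1 - gaussMul r ξ) ^ N) := by rw [e]; ring
    _ ≤ B * r ^ (b / 2) * Real.pi ^ N := by gcongr
    _ = _ := by ring

/-- The binomial formula gives `1 = (1 - G)^N - ∑_{j ≥ 1} C(N,j) (-G)^j` with `G = gaussMul r`, and
multiplication by `G^j` moves the damping time from `t` to `t + j r`. The damped kernels are thus
stable under the splitting. -/
lemma dampedKer_eq (μ : Measure (E d)) (r t : ℝ) (N : ℕ) (ξ : E d) :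
    dampedKer μ t ξ = dampedKer μ t ξ * ((1 - gaussMul r ξ) ^ N : ℝ) +
      ∑ j ∈ Finset.range N, (-((-1) ^ (j + 1) * (N.choose (j + 1) : ℂ))) *
        dampedKer μ (t + (j + 1 : ℕ) * r) ξ := by
  have h1 : (1 - gaussMul r ξ) ^ N =
      ∑ j ∈ Finset.range N, (-1) ^ (j + 1) * (N.choose (j + 1) : ℝ) * gaussMul ((j + 1 : ℕ) * r) ξ
        + 1 := by
    rw [sub_eq_neg_add, add_pow, Finset.sum_range_succ']
    simp only [one_pow, mul_one, pow_zero, Nat.choose_zero_right, Nat.cast_one]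
    congr 1
    refine Finset.sum_congr rfl fun j _ => ?_
    rw [gaussMul_natCast_mul, neg_pow]; ring
  have h2 : ∀ j : ℕ, dampedKer μ (t + (j + 1 : ℕ) * r) ξ =
      dampedKer μ t ξ * (gaussMul ((j + 1 : ℕ) * r) ξ : ℂ) := by
    intro j; unfold dampedKer; rw [gaussMul_add]; push_cast; ring
  simp_rw [h2]
  rw [h1, Complex.ofReal_add, mul_add, Complex.ofReal_one, mul_one, Complex.ofReal_sum,
    Finset.mul_sum]
  have : ∑ j ∈ Finset.range N, (-((-1) ^ (j + 1) * (N.choose (j + 1) : ℂ))) *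
        (dampedKer μ t ξ * (gaussMul ((j + 1 : ℕ) * r) ξ : ℂ)) =
      - ∑ j ∈ Finset.range N, dampedKer μ t ξ *
        (((-1) ^ (j + 1) * (N.choose (j + 1) : ℝ) * gaussMul ((j + 1 : ℕ) * r) ξ : ℝ) : ℂ) := by
    rw [← Finset.sum_neg_distrib]
    refine Finset.sum_congr rfl fun j _ => ?_
    push_cast; ring
  rw [this]; ring

lemma norm_form_dampedKer_le_of_forall {μ : Measure (E d)} [IsProbabilityMeasure μ] {r t h M : ℝ}
    (hr : 0 < r) (ht : 0 ≤ t) {N : ℕ} {f g : E d → ℂ} (hf : UnitFun f) (hg : UnitFun g)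
    (hh : ∀ ξ : E d, ‖dampedKer μ t ξ * ((1 - gaussMul r ξ) ^ N : ℝ)‖ ≤ h)
    (hM : ∀ s, t + r ≤ s → ‖form (dampedKer μ s) f g‖ ≤ M) :
    ‖form (dampedKer μ t) f g‖ ≤ 2 ^ N * M + h * (mass f * mass g) := by
  have hM0 : 0 ≤ M := (norm_nonneg _).trans (hM _ le_rfl)
  set k0 : E d → ℂ := fun ξ => dampedKer μ t ξ * ((1 - gaussMul r ξ) ^ N : ℝ) with hk0
  have hk0c : Continuous k0 := by
    have := continuous_dampedKer μ t
    have h2 : Continuous fun ξ : E d => (1 - gaussMul r ξ) ^ N := by fun_prop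
    exact this.mul (Complex.continuous_ofReal.comp h2)
  set c : ℕ → ℂ := fun j => -((-1) ^ (j + 1) * (N.choose (j + 1) : ℂ)) with hc
  have hs : ∀ j : ℕ, t + r ≤ t + (j + 1 : ℕ) * r := by
    intro j; push_cast; nlinarith [(Nat.cast_nonneg j : (0 : ℝ) ≤ j)]
  have hs0 : ∀ j : ℕ, 0 ≤ t + (j + 1 : ℕ) * r := by
    intro j; positivity
  have hi : ∀ j : ℕ, Integrable (fun p : E d × E d =>
      f p.1 * g p.2 * dampedKer μ (t + (j + 1 : ℕ) * r) (p.2 - p.1)) (volume.prod volume) :=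
    fun j => integrable_form (continuous_dampedKer μ _)
      (fun ξ => (norm_dampedKer_le μ (hs0 j) ξ).trans (norm_fourierMeasure_le_one μ ξ))
      hf.integrable hg.integrable
  have e : form (dampedKer μ t) f g = form k0 f g +
      ∑ j ∈ Finset.range N, c j * form (dampedKer μ (t + (j + 1 : ℕ) * r)) f g := by
    unfold form
    simp_rw [← integral_const_mul]
    rw [← integral_finsetSum _ (fun j _ => (hi j).const_mul (c j)), ← integral_add]
    · congr 1; ext p
      conv_lhs => rw [dampedKer_eq μ r t N]
      rw [mul_add, Finset.mul_sum]
      congr 1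
      refine Finset.sum_congr rfl fun j _ => ?_
      rw [hc]; ring
    · exact integrable_form hk0c hh hf.integrable hg.integrable
    · exact integrable_finsetSum _ (fun j _ => (hi j).const_mul (c j))
  rw [e, add_comm (2 ^ N * M)]
  refine (norm_add_le _ _).trans (add_le_add (norm_form_le hh hf.integrable hg.integrable) ?_)
  refine (norm_sum_le _ _).trans ?_
  calc ∑ j ∈ Finset.range N, ‖c j * form (dampedKer μ (t + (j + 1 : ℕ) * r)) f g‖
      ≤ ∑ j ∈ Finset.range N, (N.choose (j + 1) : ℝ) * M := by
        refine Finset.sum_le_sum fun j _ => ?_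
        rw [norm_mul]
        refine mul_le_mul (le_of_eq ?_) (hM _ (hs j)) (norm_nonneg _) (by positivity)
        simp [hc]
    _ ≤ 2 ^ N * M := by
        -- The binomial coefficients other than the zeroth sum to less than `2^N`.
        rw [← Finset.sum_mul]
        refine mul_le_mul_of_nonneg_right ?_ hM0
        have := Nat.sum_range_choose N
        rw [Finset.sum_range_succ'] at this
        have h2 : ∑ j ∈ Finset.range N, N.choose (j + 1) ≤ 2 ^ N := by omega
        exact_mod_cast h2

/-- Optimisation of a sum of two powers. -/
lemma le_of_forall_rpow_add {Q P₁ P₂ α β : ℝ} (h₁ : 0 < P₁) (h₂ : 0 < P₂)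
    (hα : 0 < α) (hβ : 0 < β)
    (h : ∀ r : ℝ, 0 < r → Q ≤ P₁ * r ^ (-α) + P₂ * r ^ β) :
    Q ≤ 2 * (P₁ ^ (β / (α + β)) * P₂ ^ (α / (α + β))) := by
  have hs : 0 < α + β := by positivity
  obtain ⟨x, rfl⟩ : ∃ x, Real.exp x = P₁ := ⟨_, Real.exp_log h₁⟩
  obtain ⟨y, rfl⟩ : ∃ y, Real.exp y = P₂ := ⟨_, Real.exp_log h₂⟩
  -- This is `r = (P₁/P₂)^(1/(α+β))`, for which the two terms are equal; hence the factor `2`.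
  refine (h (Real.exp ((x - y) / (α + β))) (Real.exp_pos _)).trans (le_of_eq ?_)
  simp only [← Real.exp_mul, ← Real.exp_add]
  rw [two_mul]
  congr 2 <;> field_simp <;> ring

lemma normBound_pos {a b A B : ℝ} (hA : 1 ≤ A) (hB : 1 ≤ B) : 0 < normBound d a b A B := by
  unfold normBound; positivity

/-- The uniform bound for the damped kernels on the line of duality. -/
theorem norm_form_dampedKer_le {a b : ℝ} (ha : 0 < a) (had : a < d) (hb : 0 < b) :
    ∃ C : ℝ, 0 < C ∧ ∀ (μ : Measure (E d)) [IsProbabilityMeasure μ] (A B : ℝ), 1 ≤ A → 1 ≤ B →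
      BallCondition μ a A → FourierDecay μ b B → ∀ (t : ℝ) (f g : E d → ℂ), 0 ≤ t →
        UnitFun f → UnitFun g → ‖form (dampedKer μ t) f g‖ ≤
          C * normBound d a b A B *
            (mass f * mass g) ^ ((2 * (d - a) + b) / (2 * (d - a + b))) := by
  have hD : 0 < (d : ℝ) - a := by linarith
  have hpi := Real.pi_pos
  have hG := gaussConst_pos a
  set N := ⌈b / 2⌉₊ with hN
  have hNb : b / 2 ≤ N := Nat.le_ceil _
  have hN0 : N ≠ 0 := (Nat.ceil_pos.2 (by positivity)).ne'
  refine ⟨2 * ((2 ^ N * gaussConst a) ^ (b / (d - a + b)) *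
    (Real.pi ^ N) ^ ((d - a) / (d - a + b))), by positivity, ?_⟩
  intro μ _ A B hA hB hball hdec t f g ht hf hg
  have hA0 : 0 < A := by linarith
  have hB0 : 0 < B := by linarith
  have hK := normBound_pos (d := d) (a := a) (b := b) hA hB
  have hm0 : 0 ≤ mass f * mass g := mul_nonneg (mass_nonneg f) (mass_nonneg g)
  -- The optimisation in `r` needs positive coefficients, so vanishing mass is treated apart.
  rcases hm0.eq_or_lt with hm | hm
  · refine (norm_form_le (c := 1) (fun ξ => (norm_dampedKer_le μ ht ξ).trans
      (norm_fourierMeasure_le_one μ ξ)) hf.integrable hg.integrable).trans ?_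
    rw [← hm]; simp only [mul_zero]; positivity
  have h : ∀ r : ℝ, 0 < r → ‖form (dampedKer μ t) f g‖ ≤
      (2 ^ N * gaussConst a * A * (mass f * mass g) ^ (1 / 2 : ℝ)) * r ^ (-((d - a) / 2)) +
        (Real.pi ^ N * B * (mass f * mass g)) * r ^ (b / 2) := by
    intro r hr
    refine (norm_form_dampedKer_le_of_forall
      (M := gaussConst a * A * r ^ (-((d - a) / 2)) * (mass f * mass g) ^ (1 / 2 : ℝ)) hr ht hf hg
      (fun ξ => norm_dampedKer_mul_tail_le hdec hb hB hr ht hN0 hNb ξ) ?_).trans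
      (le_of_eq (by ring))
    intro s hs
    have hs0 : 0 < s := by linarith
    have hS := gaussDensity_le_of_le hball ha had hA hr (show r ≤ s by linarith)
    set S := gaussConst a * A * r ^ (-((d - a) / 2)) with hSdef
    have hS0 : 0 ≤ S := by positivity
    have h1 := sq_norm_form_dampedKer_le hs0 hf hg hS
    have h2 := norm_form_dampedKer_conj_le hs0 hf hS
    rw [← Real.sqrt_eq_rpow]
    refine le_of_sq_le_sq ?_ (by positivity)
    rw [mul_pow, Real.sq_sqrt hm0]
    -- The `T T^*` inequality with the trivial diagonal bound gives `S (‖f‖₁ ‖g‖₁)^{1/2}`, of size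
    -- `r^{-(d-a)/2}`.
    calc _ ≤ _ := h1
      _ ≤ S * (S * mass f) * mass g := by
          have := mass_nonneg g
          gcongr
      _ = _ := by ring
  refine (le_of_forall_rpow_add (by positivity) (by positivity) (by positivity) (by positivity)
    h).trans (le_of_eq ?_)
  generalize mass f * mass g = m at hm
  have e1 : b / 2 / ((d - a) / 2 + b / 2) = b / (d - a + b) := by field_simp
  have e2 : (d - a) / 2 / ((d - a) / 2 + b / 2) = (d - a) / (d - a + b) := by field_simp
  rw [e1, e2]
  have hm2 : m ^ ((2 * (d - a) + b) / (2 * (d - a + b))) =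
      (m ^ (1 / 2 : ℝ)) ^ (b / (d - a + b)) * m ^ ((d - a) / (d - a + b)) := by
    rw [← Real.rpow_mul hm.le, ← Real.rpow_add hm]
    congr 1; field_simp; ring
  rw [hm2]
  unfold normBound
  rw [Real.mul_rpow (by positivity) (by positivity), Real.mul_rpow (by positivity) (by positivity),
    Real.mul_rpow (x := Real.pi ^ N * B) (by positivity) (by positivity),
    Real.mul_rpow (x := Real.pi ^ N) (by positivity) (by positivity)]
  ring

/-- The restricted bilinear estimate at the endpoint. -/
theorem norm_form_fourierMeasure_le {a b : ℝ} (ha : 0 < a) (had : a < d) (hb : 0 < b) :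
    ∃ C : ℝ, 0 < C ∧ ∀ (μ : Measure (E d)) [IsProbabilityMeasure μ] (A B : ℝ), 1 ≤ A → 1 ≤ B →
      BallCondition μ a A → FourierDecay μ b B → ∀ (f g : E d → ℂ),
        UnitFun f → UnitFun g → ‖form (fourierMeasure μ) f g‖ ≤
          C * normBound d a b A B *
            (mass f ^ (1 / rhoExp d a b) * mass g ^ (1 - 1 / sigmaExp d a b)) := by
  have hD : 0 < (d : ℝ) - a := by linarith
  have hpi := Real.pi_pos
  have hG := gaussConst_pos a
  obtain ⟨C, hC, hsym⟩ := norm_form_dampedKer_le ha had hb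
  set N := ⌈b / 2⌉₊ with hN
  have hNb : b / 2 ≤ N := Nat.le_ceil _
  have hN0 : N ≠ 0 := (Nat.ceil_pos.2 (by positivity)).ne'
  refine ⟨2 * ((2 ^ N * (gaussConst a * C) ^ (1 / 2 : ℝ)) ^ (2 * b / (d - a + 2 * b)) *
    (Real.pi ^ N) ^ ((d - a) / (d - a + 2 * b))), by positivity, ?_⟩
  intro μ _ A B hA hB hball hdec f g hf hg
  have hA0 : 0 < A := by linarith
  have hB0 : 0 < B := by linarith
  have hK := normBound_pos (d := d) (a := a) (b := b) hA hB
  have hmf := mass_nonneg f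
  have hmg := mass_nonneg g
  by_cases hm : mass f = 0 ∨ mass g = 0
  · refine (norm_form_le (c := 1) (norm_fourierMeasure_le_one μ)
      hf.integrable hg.integrable).trans ?_
    have : mass f * mass g = 0 := by simpa using hm
    rw [this, mul_zero]; positivity
  rw [not_or] at hm
  replace hmf := lt_of_le_of_ne hmf (Ne.symm hm.1)
  replace hmg := lt_of_le_of_ne hmg (Ne.symm hm.2)
  set K := normBound d a b A B with hKdef
  set e := (2 * (d - a) + b) / (2 * (d - a + b)) with he
  have h : ∀ r : ℝ, 0 < r → ‖form (fourierMeasure μ) f g‖ ≤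
      (2 ^ N * (gaussConst a * A * (C * K * (mass f * mass f) ^ e) * mass g) ^ (1 / 2 : ℝ)) *
        r ^ (-((d - a) / 4)) + (Real.pi ^ N * B * (mass f * mass g)) * r ^ (b / 2) := by
    intro r hr
    rw [← dampedKer_zero μ]
    refine (norm_form_dampedKer_le_of_forall
      (M := (gaussConst a * A * (C * K * (mass f * mass f) ^ e) * mass g) ^ (1 / 2 : ℝ) *
        r ^ (-((d - a) / 4))) hr le_rfl hf hg
      (fun ξ => norm_dampedKer_mul_tail_le hdec hb hB hr le_rfl hN0 hNb ξ) ?_).trans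
      (le_of_eq (by ring))
    intro s hs
    have hs0 : 0 < s := by linarith
    have hS := gaussDensity_le_of_le hball ha had hA hr (show r ≤ s by linarith)
    have h1 := sq_norm_form_dampedKer_le hs0 hf hg hS
    -- The symmetric estimate, uniform in the damping, now bounds the diagonal form. Only `S^{1/2}`
    -- is lost, so the growth in `r` improves to `r^{-(d-a)/4}`.
    have h2 := hsym μ A B hA hB hball hdec s f _ hs0.le hf hf.conj
    rw [mass_conj] at h2
    rw [← Real.sqrt_eq_rpow]
    refine le_of_sq_le_sq ?_ (by positivity)
    rw [mul_pow, Real.sq_sqrt (by positivity), ← Real.rpow_natCast (r ^ _), ← Real.rpow_mul hr.le]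
    calc _ ≤ _ := h1
      _ ≤ gaussConst a * A * r ^ (-((d - a) / 2)) * (C * K * (mass f * mass f) ^ e) * mass g := by
          gcongr
      _ = gaussConst a * A * (C * K * (mass f * mass f) ^ e) * mass g * r ^ (-((d - a) / 2)) := by
          ring
      _ = _ := by congr 2; push_cast; ring
  refine (le_of_forall_rpow_add (by positivity) (by positivity) (by positivity) (by positivity)
    h).trans (le_of_eq ?_)
  have e1 : b / 2 / ((d - a) / 4 + b / 2) = 2 * b / (d - a + 2 * b) := by field_simp; ring
  have e2 : (d - a) / 4 / ((d - a) / 4 + b / 2) = (d - a) / (d - a + 2 * b) := by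
    field_simp; ring
  rw [e1, e2, hKdef, he]
  unfold normBound rhoExp sigmaExp
  have h2N : (0 : ℝ) < 2 ^ N := by positivity
  have hpN : (0 : ℝ) < Real.pi ^ N := by positivity
  generalize mass f = m at hmf
  generalize mass g = n at hmg
  generalize gaussConst a = G at hG
  generalize (2 : ℝ) ^ N = T at h2N
  generalize Real.pi ^ N = P at hpN
  generalize (d : ℝ) - a = D at hD
  clear e1 e2 h hsym hball hdec hKdef hK he
  -- With all positive quantities written as exponentials, the identity of monomials becomes a
  -- linear identity between exponents, which verifies the values of `ρ` and `σ`.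
  obtain ⟨m, rfl⟩ : ∃ x, Real.exp x = m := ⟨_, Real.exp_log hmf⟩
  obtain ⟨n, rfl⟩ : ∃ x, Real.exp x = n := ⟨_, Real.exp_log hmg⟩
  obtain ⟨G, rfl⟩ : ∃ x, Real.exp x = G := ⟨_, Real.exp_log hG⟩
  obtain ⟨T, rfl⟩ : ∃ x, Real.exp x = T := ⟨_, Real.exp_log h2N⟩
  obtain ⟨P, rfl⟩ : ∃ x, Real.exp x = P := ⟨_, Real.exp_log hpN⟩
  obtain ⟨A, rfl⟩ : ∃ x, Real.exp x = A := ⟨_, Real.exp_log hA0⟩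
  obtain ⟨B, rfl⟩ : ∃ x, Real.exp x = B := ⟨_, Real.exp_log hB0⟩
  obtain ⟨C, rfl⟩ : ∃ x, Real.exp x = C := ⟨_, Real.exp_log hC⟩
  simp only [mul_assoc (2 : ℝ) _ _]
  congr 1
  simp only [← Real.exp_mul, ← Real.exp_add]
  congr 1
  have h3 : D ^ 2 + 3 * b * D + b ^ 2 ≠ 0 := by positivity
  field_simp
  ring

/-! ### Absolute integrability of the kernel over sets of finite measure. -/

lemma integral_gaussDensity (μ : Measure (E d)) [IsProbabilityMeasure μ] {t : ℝ} (ht : 0 < t) :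
    ∫ w : E d, gaussDensity μ t w = 1 := by
  have h := integral_phase_mul_gaussDensity μ ht 0
  have h1 : ∀ x : E d, phase x 0 = 1 := by intro x; simp [phase]
  simp only [h1, one_mul, gaussMul, norm_zero, fourierMeasure_eq] at h
  rw [integral_complex_ofReal] at h
  have h2 : ((∫ w : E d, gaussDensity μ t w : ℝ) : ℂ) = 1 := by simpa using h
  exact_mod_cast h2

/-- Bessel's inequality applied to the density divided by `S`: this function is bounded by `1`, has
mass `1/S`, and its Fourier integral is the damped kernel divided by `S`. -/
lemma integrable_normSq_dampedKer {μ : Measure (E d)} [IsProbabilityMeasure μ] {t S : ℝ}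
    (ht : 0 < t) (hS0 : 0 < S) (hS : ∀ w, gaussDensity μ t w ≤ S) :
    Integrable (fun ξ : E d => ‖dampedKer μ t ξ‖ ^ 2) ∧
      ∫ ξ : E d, ‖dampedKer μ t ξ‖ ^ 2 ≤ S := by
  set f : E d → ℂ := fun w => ((S⁻¹ * gaussDensity μ t w : ℝ) : ℂ) with hf
  have hD := integrable_gaussDensity μ ht
  have hD0 := gaussDensity_nonneg μ ht
  have hnorm : ∀ w, ‖f w‖ = S⁻¹ * gaussDensity μ t w := fun w => by
    rw [hf, Complex.norm_real, Real.norm_of_nonneg (mul_nonneg (inv_nonneg.2 hS0.le) (hD0 w))]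
  have hu : UnitFun f := by
    refine ⟨(hD.const_mul S⁻¹).ofReal, fun w => ?_⟩
    rw [hnorm, inv_mul_le_iff₀ hS0, mul_one]
    exact hS w
  have hmass : mass f = S⁻¹ := by
    unfold mass
    simp_rw [hnorm]
    rw [integral_const_mul, integral_gaussDensity μ ht, mul_one]
  have hft : ∀ ξ, fourierInt f ξ = (S⁻¹ : ℝ) * dampedKer μ t ξ := by
    intro ξ
    unfold fourierInt dampedKer
    rw [← integral_phase_mul_gaussDensity μ ht, ← integral_const_mul]
    congr 1; ext w
    rw [hf]; push_cast; ring
  have hsq : ∀ ξ, ‖fourierInt f ξ‖ ^ 2 = S⁻¹ ^ 2 * ‖dampedKer μ t ξ‖ ^ 2 := by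
    intro ξ
    rw [hft, norm_mul, Complex.norm_real, Real.norm_of_nonneg (inv_nonneg.2 hS0.le), mul_pow]
  have h1 := integrable_normSq_fourierInt hu
  have h2 := integral_normSq_fourierInt_le hu
  simp_rw [hsq] at h1 h2
  rw [integral_const_mul, hmass] at h2
  constructor
  · have := h1.const_mul (S ^ 2)
    refine this.congr (Filter.Eventually.of_forall fun ξ => ?_)
    simp only; field_simp
  · have h3 : 0 < S⁻¹ := inv_pos.2 hS0
    rw [sq, mul_assoc] at h2
    have h4 := le_of_mul_le_mul_left (h2.trans_eq (mul_one _).symm) h3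
    rwa [inv_mul_le_iff₀ hS0, mul_one] at h4

/-- Where `r‖ξ‖² ≤ 1` the Gaussian is at least `e^{-π}`; elsewhere the Fourier decay applies. This
pointwise splitting survives absolute values, unlike the estimates of the bilinear form. -/
lemma norm_fourierMeasure_le_damped {μ : Measure (E d)} [IsProbabilityMeasure μ] {b B : ℝ}
    (h : FourierDecay μ b B) (hb : 0 < b) (hB : 1 ≤ B) {r : ℝ} (hr : 0 < r) (ξ : E d) :
    ‖fourierMeasure μ ξ‖ ≤ Real.exp Real.pi * ‖dampedKer μ r ξ‖ + B * r ^ (b / 2) := by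
  have hpi := Real.pi_pos
  rcases le_or_gt (r * ‖ξ‖ ^ 2) 1 with h1 | h1
  · refine le_add_of_le_of_nonneg ?_ (by positivity)
    unfold dampedKer
    rw [norm_mul, Complex.norm_real, Real.norm_of_nonneg (gaussMul_pos _ _).le]
    have h2 : 1 ≤ Real.exp Real.pi * gaussMul r ξ := by
      unfold gaussMul
      rw [← Real.exp_add, Real.one_le_exp_iff]
      nlinarith
    nlinarith [norm_nonneg (fourierMeasure μ ξ)]
  · have hξ : ξ ≠ 0 := by rintro rfl; simp at h1; linarith
    have h0 : 0 < ‖ξ‖ := norm_pos_iff.2 hξ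
    refine le_add_of_nonneg_of_le (by positivity) ((h.norm_le hb hB hξ).trans ?_)
    refine mul_le_mul_of_nonneg_left ?_ (by linarith)
    have h3 : ‖ξ‖ ^ (-b) = (‖ξ‖ ^ 2) ^ (-(b / 2)) := by
      rw [← Real.rpow_natCast, ← Real.rpow_mul h0.le]; congr 1; push_cast; ring
    have h4 : r ^ (b / 2) = (r⁻¹) ^ (-(b / 2)) := by
      rw [Real.inv_rpow hr.le, Real.rpow_neg hr.le, inv_inv]
    rw [h3, h4]
    refine Real.rpow_le_rpow_of_nonpos (by positivity) ?_ (by linarith)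
    rw [inv_le_iff_one_le_mul₀ hr]; linarith

/-- Integrals of `μ̂` over sets of finite measure. -/
lemma lintegral_fourierMeasure_le {μ : Measure (E d)} [IsProbabilityMeasure μ] {a b A B : ℝ}
    (ha : 0 < a) (had : a < d) (hb : 0 < b) (hA : 1 ≤ A) (hB : 1 ≤ B)
    (hball : BallCondition μ a A) (hdec : FourierDecay μ b B) :
    ∃ C : ℝ≥0∞, C ≠ ⊤ ∧ ∀ (x : E d) (S : Set (E d)), MeasurableSet S →
      ∫⁻ y in S, ‖fourierMeasure μ (x - y)‖ₑ ≤ C * volume S ^ (1 - 1 / sigmaExp d a b) := by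
  have hD : 0 < (d : ℝ) - a := by linarith
  have hG := gaussConst_pos a
  have hpi := Real.pi_pos
  have hσ : 0 < 1 - 1 / sigmaExp d a b := by
    unfold sigmaExp
    rw [one_div_div, sub_pos, div_lt_one (by positivity)]; linarith
  set c : ℝ := 2 * ((Real.exp Real.pi * (gaussConst a * A) ^ (1 / 2 : ℝ)) ^
    (2 * b / (d - a + 2 * b)) * B ^ ((d - a) / (d - a + 2 * b))) with hc
  have hc0 : 0 < c := by positivity
  refine ⟨ENNReal.ofReal c, ENNReal.ofReal_ne_top, fun x S hS => ?_⟩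
  rcases eq_or_ne (volume S) 0 with h0 | h0
  · rw [Measure.restrict_eq_zero.2 h0]; simp
  rcases eq_or_ne (volume S) ⊤ with h1 | h1
  · rw [h1, ENNReal.top_rpow_of_pos hσ, ENNReal.mul_top (by simpa using hc0)]; exact le_top
  have hv : 0 < (volume S).toReal := ENNReal.toReal_pos h0 h1
  set v := (volume S).toReal with hvdef
  have hVv : volume S = ENNReal.ofReal v := (ENNReal.ofReal_toReal h1).symm
  have : IsFiniteMeasure (volume.restrict S) := ⟨by
    rw [Measure.restrict_apply_univ]; exact h1.lt_top⟩
  have hcont : Continuous fun y : E d => fourierMeasure μ (x - y) :=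
    (continuous_fourierMeasure μ).comp (by fun_prop)
  have hint : Integrable (fun y : E d => fourierMeasure μ (x - y)) (volume.restrict S) :=
    Integrable.of_bound hcont.aestronglyMeasurable 1
      (Filter.Eventually.of_forall fun y => norm_fourierMeasure_le_one μ _)
  have key : ∀ r : ℝ, 0 < r → ∫ y in S, ‖fourierMeasure μ (x - y)‖ ≤
      (Real.exp Real.pi * (gaussConst a * A * v) ^ (1 / 2 : ℝ)) * r ^ (-((d - a) / 4)) +
        B * v * r ^ (b / 2) := by
    intro r hr
    have hcd : Continuous fun y : E d => dampedKer μ r (x - y) :=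
      (continuous_dampedKer μ r).comp (by fun_prop)
    have hid : Integrable (fun y : E d => ‖dampedKer μ r (x - y)‖) (volume.restrict S) :=
      Integrable.of_bound hcd.norm.aestronglyMeasurable 1
        (Filter.Eventually.of_forall fun y => by
          rw [norm_norm]
          exact (norm_dampedKer_le μ hr.le _).trans (norm_fourierMeasure_le_one μ _))
    have hSup := gaussDensity_le_of_le hball ha had hA hr le_rfl
    set Sp := gaussConst a * A * r ^ (-((d - a) / 2)) with hSp
    have hSp0 : 0 < Sp := by positivity
    obtain ⟨i1, i2⟩ := integrable_normSq_dampedKer hr hSp0 hSup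
    have i1' := i1.comp_sub_left x
    -- Cauchy–Schwarz on `S` with the `L²` bound of the damped kernel. The powers of `r` are those
    -- of the endpoint estimate, so the optimised power of `|S|` is again `1 - 1/σ`.
    have cs : ∫ y in S, ‖dampedKer μ r (x - y)‖ ≤
        (gaussConst a * A * v) ^ (1 / 2 : ℝ) * r ^ (-((d - a) / 4)) := by
      have h2 := sq_integral_mul_le (μ := volume.restrict S) (u := fun _ => (1 : ℝ))
        (v := fun y : E d => ‖dampedKer μ r (x - y)‖) aestronglyMeasurable_const
        hcd.norm.aestronglyMeasurable (fun _ => zero_le_one) (fun _ => norm_nonneg _)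
        (integrable_const _) i1'.integrableOn
      have h3 : ∫ y in S, ‖dampedKer μ r (x - y)‖ ^ 2 ≤ Sp := by
        refine (setIntegral_le_integral i1' (Filter.Eventually.of_forall fun y =>
          sq_nonneg _)).trans ?_
        rw [integral_sub_left_eq_self (fun ξ : E d => ‖dampedKer μ r ξ‖ ^ 2)]
        exact i2
      simp only [one_mul, one_pow, integral_const, measureReal_restrict_apply_univ, smul_eq_mul,
        mul_one] at h2
      rw [← Real.sqrt_eq_rpow]
      refine le_of_sq_le_sq ?_ (by positivity)
      rw [mul_pow, Real.sq_sqrt (by positivity), ← Real.rpow_natCast (r ^ _),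
        ← Real.rpow_mul hr.le]
      calc _ ≤ _ := h2
        _ ≤ v * Sp := mul_le_mul_of_nonneg_left h3 hv.le
        _ = gaussConst a * A * v * r ^ (-((d - a) / 2)) := by rw [hSp]; ring
        _ = _ := by congr 2; push_cast; ring
    calc ∫ y in S, ‖fourierMeasure μ (x - y)‖
        ≤ ∫ y in S, (Real.exp Real.pi * ‖dampedKer μ r (x - y)‖ + B * r ^ (b / 2)) := by
          refine integral_mono hint.norm ((hid.const_mul _).add (integrable_const _)) fun y => ?_
          exact norm_fourierMeasure_le_damped hdec hb hB hr _
      _ = Real.exp Real.pi * (∫ y in S, ‖dampedKer μ r (x - y)‖) + v * (B * r ^ (b / 2)) := by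
          rw [integral_add (hid.const_mul _) (integrable_const _), integral_const_mul,
            integral_const, measureReal_restrict_apply_univ]
          rfl
      _ ≤ Real.exp Real.pi * ((gaussConst a * A * v) ^ (1 / 2 : ℝ) * r ^ (-((d - a) / 4))) +
            v * (B * r ^ (b / 2)) := by gcongr
      _ = _ := by ring
  have hB0 : 0 < B := by linarith
  have hA0 : 0 < A := by linarith
  have fin := le_of_forall_rpow_add (by positivity) (by positivity) (by positivity)
    (by positivity) key
  have e1 : b / 2 / ((d - a) / 4 + b / 2) = 2 * b / (d - a + 2 * b) := by field_simp; ring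
  have e2 : (d - a) / 4 / ((d - a) / 4 + b / 2) = (d - a) / (d - a + 2 * b) := by
    field_simp; ring
  have e3 : v ^ (1 - 1 / sigmaExp d a b) =
      (v ^ (1 / 2 : ℝ)) ^ (2 * b / (d - a + 2 * b)) * v ^ ((d - a) / (d - a + 2 * b)) := by
    rw [← Real.rpow_mul hv.le, ← Real.rpow_add hv]
    congr 1; unfold sigmaExp; field_simp; ring
  have fin2 : ∫ y in S, ‖fourierMeasure μ (x - y)‖ ≤ c * v ^ (1 - 1 / sigmaExp d a b) := by
    refine fin.trans (le_of_eq ?_)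
    rw [e1, e2, e3, hc, Real.mul_rpow (x := gaussConst a * A) (by positivity) hv.le,
      ← mul_assoc (Real.exp Real.pi),
      Real.mul_rpow (y := v ^ (1 / 2 : ℝ)) (by positivity) (by positivity),
      Real.mul_rpow (x := B) (by positivity) (by positivity)]
    ring
  have h5 : ∫⁻ y in S, ‖fourierMeasure μ (x - y)‖ₑ =
      ENNReal.ofReal (∫ y in S, ‖fourierMeasure μ (x - y)‖) := by
    rw [ofReal_integral_norm_eq_lintegral_enorm hint]
  rw [h5, hVv, ENNReal.ofReal_rpow_of_pos hv, ← ENNReal.ofReal_mul hc0.le]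
  exact ENNReal.ofReal_le_ofReal fin2

/-! ### Level set decomposition and bounds for the convolution. -/

/-- The bound obtained by integrating restricted type bounds over the level sets of a function
with distribution function `l`. -/
def layerInt (l : ℝ → ℝ≥0∞) (α' α : ℝ) (m : ℝ≥0∞) : ℝ≥0∞ :=
  ∫⁻ t in Set.Ioi (0 : ℝ), min (l t ^ α' * m ^ α) (l t ^ α * m ^ α')

lemma layerInt_mono (l : ℝ → ℝ≥0∞) {α' α : ℝ} (hα' : 0 ≤ α') (hα : 0 ≤ α) {m n : ℝ≥0∞}
    (h : m ≤ n) : layerInt l α' α m ≤ layerInt l α' α n := by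
  unfold layerInt
  gcongr

/-- Kernels satisfying restricted type bilinear bounds at two dual points. -/
structure RestrictedKernel (k : E d → ℂ) (α' α : ℝ) (K : ℝ≥0∞) : Prop where
  continuous : Continuous k
  norm_le : ∀ x, ‖k x‖ ≤ 1
  -- This constant is purely qualitative: it secures absolute convergence and does not enter the
  -- operator norm.
  setLIntegral_le : ∃ C : ℝ≥0∞, C ≠ ⊤ ∧ ∀ (x : E d) (S : Set (E d)), MeasurableSet S →
    ∫⁻ y in S, ‖k (x - y)‖ₑ ≤ C * volume S ^ α
  enorm_form_le : ∀ f g : E d → ℂ, UnitFun f → UnitFun g →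
    ‖form k f g‖ₑ ≤ K * min (ENNReal.ofReal (mass f) ^ α' * ENNReal.ofReal (mass g) ^ α)
      (ENNReal.ofReal (mass f) ^ α * ENNReal.ofReal (mass g) ^ α')

lemma antitone_distribution (f : E d → ℂ) : Antitone (distribution f) := fun _ _ h =>
  measure_mono fun _ hx => lt_of_le_of_lt h hx

lemma measurable_distribution (f : E d → ℂ) : Measurable (distribution f) :=
  (antitone_distribution f).measurable

lemma distribution_congr {f g : E d → ℂ} (h : f =ᵐ[volume] g) :
    distribution f = distribution g := by
  ext t
  refine measure_congr ?_
  filter_upwards [h] with x hx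
  exact congrArg (fun z : ℂ => t < ‖z‖) hx

/-- The slice at height `t` in the layer cake decomposition of `f`. -/
def layer (f : E d → ℂ) (t : ℝ) (y : E d) : ℂ := if t < ‖f y‖ then f y / ‖f y‖ else 0

lemma norm_layer {f : E d → ℂ} {t : ℝ} (ht : 0 < t) (y : E d) :
    ‖layer f t y‖ = {y | t < ‖f y‖}.indicator (fun _ => (1 : ℝ)) y := by
  unfold layer
  by_cases h : t < ‖f y‖
  · have h0 : ‖f y‖ ≠ 0 := by linarith
    simp [h, h0]
  · simp [h]

lemma measurable_layer {f : E d → ℂ} (hf : Measurable f) :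
    Measurable fun q : E d × ℝ => layer f q.2 q.1 := by
  unfold layer
  refine Measurable.ite (measurableSet_lt measurable_snd (hf.comp measurable_fst).norm) ?_
    measurable_const
  exact (hf.comp measurable_fst).div
    (Complex.measurable_ofReal.comp (hf.comp measurable_fst).norm)

lemma integral_layer (f : E d → ℂ) (y : E d) :
    ∫ t in Set.Ioi (0 : ℝ), layer f t y = f y := by
  have h : ∀ t : ℝ, layer f t y = (Set.Iio ‖f y‖).indicator (fun _ => f y / ‖f y‖) t := by
    intro t; simp [layer, Set.indicator]
  simp_rw [h]
  rw [integral_indicator_const _ measurableSet_Iio, measureReal_def,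
    Measure.restrict_apply measurableSet_Iio, Set.Iio_inter_Ioi, Real.volume_Ioo, sub_zero,
    ENNReal.toReal_ofReal (norm_nonneg _), Complex.real_smul]
  rcases eq_or_ne (f y) 0 with h0 | h0
  · simp [h0]
  · have : (‖f y‖ : ℂ) ≠ 0 := by simpa using h0
    field_simp

lemma lintegral_enorm_layer (f : E d → ℂ) (y : E d) :
    ∫⁻ t in Set.Ioi (0 : ℝ), ‖layer f t y‖ₑ = ‖f y‖ₑ := by
  have h : ∀ t : ℝ, ‖layer f t y‖ₑ = (Set.Iio ‖f y‖).indicator (fun _ => ‖f y / ‖f y‖‖ₑ) t := by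
    intro t; simp only [layer, Set.indicator, Set.mem_Iio]; split_ifs <;> simp
  simp_rw [h]
  rw [lintegral_indicator_const measurableSet_Iio,
    Measure.restrict_apply measurableSet_Iio, Set.Iio_inter_Ioi, Real.volume_Ioo, sub_zero]
  rcases eq_or_ne (f y) 0 with h0 | h0
  · simp [h0]
  · have : ‖f y / (‖f y‖ : ℂ)‖ = 1 := by
      rw [norm_div, Complex.norm_real, norm_norm, div_self (by simpa using h0)]
    rw [← ofReal_norm (f y / _), this, ENNReal.ofReal_one, one_mul, ofReal_norm]

lemma unitFun_layer {f : E d → ℂ} (hf : Measurable f) {t : ℝ} (ht : 0 < t)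
    (hd : distribution f t < ⊤) :
    UnitFun (layer f t) ∧ ENNReal.ofReal (mass (layer f t)) = distribution f t := by
  have hS : MeasurableSet {y | t < ‖f y‖} := measurableSet_lt measurable_const hf.norm
  have hm : Measurable (layer f t) :=
    (measurable_layer hf).comp (measurable_id.prodMk measurable_const)
  have hi : Integrable ({y | t < ‖f y‖}.indicator (fun _ => (1 : ℝ))) :=
    (integrable_indicator_iff hS).2 (integrableOn_const hd.ne)
  refine ⟨⟨hi.mono' hm.aestronglyMeasurable
    (Filter.Eventually.of_forall fun y => (norm_layer ht y).le), fun y => ?_⟩, ?_⟩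
  · rw [norm_layer ht]
    exact Set.indicator_le_self' (f := fun _ => (1 : ℝ)) (fun _ _ => zero_le_one) y
  · unfold mass
    simp_rw [norm_layer ht]
    rw [integral_indicator_const _ hS, smul_eq_mul, mul_one]
    exact ENNReal.ofReal_toReal hd.ne

section

variable {k : E d → ℂ} {α' α : ℝ} {K : ℝ≥0∞} {f g : E d → ℂ}

/-- The layer cake formula reduces to integrals of `|k|` over level sets. Those of measure at most
`1` are handled by `|k| ≤ 1`, the others by `setLIntegral_le`; these are the two regimes of the
minimum in `layerInt` at `m = 1`. -/
lemma RestrictedKernel.lintegral_conv_le (hk : RestrictedKernel k α' α K) (hα : α ≤ α')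
    (hα1 : α' ≤ 1) :
    ∃ C : ℝ≥0∞, C ≠ ⊤ ∧ ∀ f : E d → ℂ, Measurable f → ∀ x,
      ∫⁻ y, ‖f y‖ₑ * ‖k (x - y)‖ₑ ≤ C * layerInt (distribution f) α' α 1 := by
  obtain ⟨C, hC, hloc⟩ := hk.setLIntegral_le
  refine ⟨1 + C, by simp [hC], fun f hf x => ?_⟩
  have hkm : Measurable fun y => ‖k (x - y)‖ₑ :=
    (hk.continuous.comp (by fun_prop : Continuous fun y : E d => x - y)).measurable.enorm
  have h1 : ∫⁻ y, ‖f y‖ₑ * ‖k (x - y)‖ₑ =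
      ∫⁻ t in Set.Ioi (0 : ℝ), ∫⁻ y in {y | t < ‖f y‖}, ‖k (x - y)‖ₑ := by
    have h2 := lintegral_eq_lintegral_meas_lt (volume.withDensity fun y => ‖k (x - y)‖ₑ)
      (f := fun y => ‖f y‖) (Filter.Eventually.of_forall fun _ => norm_nonneg _)
      hf.norm.aemeasurable
    simp_rw [ofReal_norm] at h2
    rw [lintegral_withDensity_eq_lintegral_mul _ hkm hf.enorm] at h2
    simp only [Pi.mul_apply] at h2
    simp_rw [mul_comm ‖f _‖ₑ]
    rw [h2]
    refine lintegral_congr fun t => ?_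
    rw [withDensity_apply _ (measurableSet_lt measurable_const hf.norm)]
  rw [h1]
  unfold layerInt
  rw [← lintegral_const_mul' _ _ (by simp [hC])]
  refine lintegral_mono fun t => ?_
  have hS : MeasurableSet {y | t < ‖f y‖} := measurableSet_lt measurable_const hf.norm
  have b1 : ∫⁻ y in {y | t < ‖f y‖}, ‖k (x - y)‖ₑ ≤ distribution f t := by
    calc _ ≤ ∫⁻ y in {y | t < ‖f y‖}, 1 := lintegral_mono fun y => by
          rw [← ofReal_norm, ← ENNReal.ofReal_one]
          exact ENNReal.ofReal_le_ofReal (hk.norm_le _)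
      _ = _ := by rw [setLIntegral_one]; rfl
  have b2 : ∫⁻ y in {y | t < ‖f y‖}, ‖k (x - y)‖ₑ ≤ C * distribution f t ^ α := hloc x _ hS
  simp only [ENNReal.one_rpow, mul_one]
  generalize distribution f t = l at b1 b2
  rw [add_mul, one_mul]
  rcases le_total l 1 with hl | hl
  · have e1 : l ^ α' ≤ l ^ α := ENNReal.rpow_le_rpow_of_exponent_ge hl hα
    rw [min_eq_left e1]
    refine b1.trans (le_add_right ?_)
    simpa using ENNReal.rpow_le_rpow_of_exponent_ge hl hα1
  · have e1 : l ^ α ≤ l ^ α' := ENNReal.rpow_le_rpow_of_exponent_le hl hα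
    rw [min_eq_right e1]
    exact b2.trans le_add_self

/-- Justifies Fubini both for slicing `f` and for evaluating the form as the integral of `g` times
the convolution. -/
lemma integrable_layer_prod (hk : RestrictedKernel k α' α K) (hα : α ≤ α') (hα1 : α' ≤ 1)
    (hf : Measurable f) (hfin : layerInt (distribution f) α' α 1 < ⊤) (hg : Integrable g) :
    Integrable (fun q : (E d × E d) × ℝ => layer f q.2 q.1.1 * g q.1.2 * k (q.1.2 - q.1.1))
      ((volume.prod volume).prod (volume.restrict (Set.Ioi 0))) ∧
    Integrable (fun p : E d × E d => f p.1 * g p.2 * k (p.2 - p.1)) (volume.prod volume) := by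
  obtain ⟨C, hC, hle⟩ := hk.lintegral_conv_le hα hα1
  have hkc : Continuous fun p : E d × E d => k (p.2 - p.1) := hk.continuous.comp (by fun_prop)
  have hgm : AEStronglyMeasurable (fun p : E d × E d => g p.2) (volume.prod volume) :=
    hg.aestronglyMeasurable.comp_snd
  have hm2 : AEStronglyMeasurable (fun p : E d × E d => f p.1 * g p.2 * k (p.2 - p.1))
      (volume.prod volume) :=
    ((hf.comp measurable_fst).aestronglyMeasurable.mul hgm).mul hkc.aestronglyMeasurable
  have hm3 : AEStronglyMeasurable
      (fun q : (E d × E d) × ℝ => layer f q.2 q.1.1 * g q.1.2 * k (q.1.2 - q.1.1))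
      ((volume.prod volume).prod (volume.restrict (Set.Ioi 0))) := by
    have l1 : Measurable fun q : (E d × E d) × ℝ => layer f q.2 q.1.1 :=
      (measurable_layer hf).comp
        ((measurable_fst.comp measurable_fst).prodMk measurable_snd)
    exact (l1.aestronglyMeasurable.mul hgm.comp_fst).mul hkc.aestronglyMeasurable.comp_fst
  have hfin2 : ∫⁻ p : E d × E d, ‖f p.1 * g p.2 * k (p.2 - p.1)‖ₑ ∂(volume.prod volume) < ⊤ := by
    rw [lintegral_prod_symm _ hm2.enorm]
    calc ∫⁻ x, ∫⁻ y, ‖f y * g x * k (x - y)‖ₑ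
        ≤ ∫⁻ x, ‖g x‖ₑ * (C * layerInt (distribution f) α' α 1) := by
          refine lintegral_mono fun x => ?_
          calc ∫⁻ y, ‖f y * g x * k (x - y)‖ₑ = ∫⁻ y, ‖g x‖ₑ * (‖f y‖ₑ * ‖k (x - y)‖ₑ) := by
                refine lintegral_congr fun y => ?_
                rw [enorm_mul, enorm_mul]; ring
            _ = ‖g x‖ₑ * ∫⁻ y, ‖f y‖ₑ * ‖k (x - y)‖ₑ := by
                rw [lintegral_const_mul' _ _ enorm_ne_top]
            _ ≤ _ := by gcongr; exact hle f hf x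
      _ = (∫⁻ x, ‖g x‖ₑ) * (C * layerInt (distribution f) α' α 1) :=
          lintegral_mul_const' _ _ (ENNReal.mul_ne_top hC hfin.ne)
      _ < ⊤ := ENNReal.mul_lt_top hg.2 (ENNReal.mul_lt_top hC.lt_top hfin)
  refine ⟨⟨hm3, ?_⟩, ⟨hm2, hfin2⟩⟩
  rw [hasFiniteIntegral_iff_enorm, lintegral_prod _ hm3.enorm]
  refine lt_of_le_of_lt (lintegral_mono fun p => le_of_eq ?_) hfin2
  simp_rw [enorm_mul, mul_assoc]
  rw [lintegral_mul_const' _ _ (ENNReal.mul_ne_top enorm_ne_top enorm_ne_top),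
    lintegral_enorm_layer]

lemma RestrictedKernel.enorm_form_le_layerInt (hk : RestrictedKernel k α' α K) (hα0 : 0 < α)
    (hα : α ≤ α') (hα1 : α' ≤ 1) (hK : K ≠ ⊤)
    (hf : Measurable f) (hfin : layerInt (distribution f) α' α 1 < ⊤) (hg : UnitFun g) :
    ‖form k f g‖ₑ ≤ K * layerInt (distribution f) α' α (ENNReal.ofReal (mass g)) := by
  obtain ⟨h3, -⟩ := integrable_layer_prod hk hα hα1 hf hfin hg.integrable
  have e : form k f g = ∫ t in Set.Ioi (0 : ℝ), form k (layer f t) g := by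
    unfold form
    rw [← integral_integral_swap h3]
    congr 1; ext p
    simp_rw [mul_assoc]
    rw [integral_mul_const, integral_layer]
  -- Both exponents being positive, a level set of infinite measure makes the integrand of
  -- `layerInt` infinite.
  have hfin' : ∀ᵐ t ∂(volume.restrict (Set.Ioi (0 : ℝ))), distribution f t < ⊤ := by
    have hm : Measurable fun t => min (distribution f t ^ α' * (1 : ℝ≥0∞) ^ α)
        (distribution f t ^ α * (1 : ℝ≥0∞) ^ α') := by
      have := measurable_distribution f
      exact ((this.pow_const _).mul_const _).min ((this.pow_const _).mul_const _)
    filter_upwards [ae_lt_top hm hfin.ne] with t ht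
    by_contra h
    rw [not_lt, top_le_iff] at h
    rw [h, ENNReal.top_rpow_of_pos hα0, ENNReal.top_rpow_of_pos (hα0.trans_le hα)] at ht
    simp at ht
  rw [e]
  refine (enorm_integral_le_lintegral_enorm _).trans ?_
  unfold layerInt
  rw [← lintegral_const_mul' _ _ hK]
  refine lintegral_mono_ae ?_
  filter_upwards [hfin', ae_restrict_mem measurableSet_Ioi] with t ht ht0
  obtain ⟨hu, hmass⟩ := unitFun_layer hf ht0 ht
  have := hk.enorm_form_le _ _ hu hg
  rwa [hmass] at this

lemma conv_apply (f k : E d → ℂ) (x : E d) : conv f k x = ∫ y, f y * k (x - y) := rfl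

lemma RestrictedKernel.conv_bound_of_measurable (hk : RestrictedKernel k α' α K) (hα0 : 0 < α)
    (hα : α ≤ α') (hα1 : α' ≤ 1) (hK : K ≠ ⊤)
    (hf : Measurable f) (hfin : layerInt (distribution f) α' α 1 < ⊤) :
    ConvolutionExists f k (ContinuousLinearMap.mul ℂ ℂ) volume ∧
    AEStronglyMeasurable (conv f k) volume ∧
    ∀ u : ℝ, 0 < u → ∀ c < distribution (conv f k) u, ∃ m, c < m ∧ m < ⊤ ∧
      ENNReal.ofReal u * m ≤ K * layerInt (distribution f) α' α m := by
  obtain ⟨C, hC, hle⟩ := hk.lintegral_conv_le hα hα1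
  have hkx : ∀ x, Continuous fun y : E d => k (x - y) := fun x => hk.continuous.comp (by fun_prop)
  have hM := ENNReal.mul_lt_top hC.lt_top hfin
  set M := C * layerInt (distribution f) α' α 1 with hMdef
  have hex : ConvolutionExists f k (ContinuousLinearMap.mul ℂ ℂ) volume := by
    intro x
    refine ⟨?_, ?_⟩
    · exact hf.aestronglyMeasurable.mul (hkx x).aestronglyMeasurable
    · refine lt_of_le_of_lt (lintegral_mono fun y => ?_) ((hle f hf x).trans_lt hM)
      simp [enorm_mul]
  have hmeas : AEStronglyMeasurable (conv f k) volume := by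
    have : AEStronglyMeasurable (fun p : E d × E d => f p.2 * k (p.1 - p.2))
        (volume.prod volume) :=
      (hf.comp measurable_snd).aestronglyMeasurable.mul
        (hk.continuous.comp (by fun_prop : Continuous fun p : E d × E d => p.1 - p.2)).aestronglyMeasurable
    exact this.integral_prod_right'
  have hbdd : ∀ x, ‖conv f k x‖ ≤ M.toReal := by
    intro x
    rw [← ENNReal.ofReal_le_iff_le_toReal hM.ne, ofReal_norm, conv_apply]
    refine (enorm_integral_le_lintegral_enorm _).trans ?_
    simp_rw [enorm_mul]
    exact hle f hf x
  refine ⟨hex, hmeas, fun u hu c hc => ?_⟩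
  set T := conv f k with hT
  set T' := hmeas.mk T with hT'
  have hTT' : T =ᵐ[volume] T' := hmeas.ae_eq_mk
  have hT'm : Measurable T' := hmeas.stronglyMeasurable_mk.measurable
  rw [distribution_congr hTT'] at hc
  -- The superlevel set may have infinite measure; a subset of finite measure greater than `c` is
  -- enough, and its measure is the required `m`.
  obtain ⟨S, hSm, hSsub, hcS, hSfin⟩ := Measure.exists_subset_measure_lt_top
    (measurableSet_lt measurable_const hT'm.norm) hc
  refine ⟨volume S, hcS, hSfin, ?_⟩
  -- The conjugate phase of the convolution on `S`, so that `form k f g` is the integral of its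
  -- modulus over `S`, at least `u |S|`.
  set g : E d → ℂ := S.indicator fun x => (starRingEnd ℂ) (T' x) / ‖T' x‖ with hg
  have hgm : Measurable g :=
    ((Complex.continuous_conj.measurable.comp hT'm).div
      (Complex.measurable_ofReal.comp hT'm.norm)).indicator hSm
  have hgn : ∀ x, ‖g x‖ ≤ S.indicator (fun _ => (1 : ℝ)) x := by
    intro x
    rw [hg, norm_indicator_eq_indicator_norm]
    refine Set.indicator_le_indicator ?_
    rw [norm_div, RCLike.norm_conj, Complex.norm_real, norm_norm]
    exact div_self_le_one _
  have hSi : Integrable (S.indicator (fun _ => (1 : ℝ))) :=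
    (integrable_indicator_iff hSm).2 (integrableOn_const hSfin.ne)
  have hgu : UnitFun g := by
    refine ⟨hSi.mono' hgm.aestronglyMeasurable (Filter.Eventually.of_forall hgn), fun x => ?_⟩
    exact (hgn x).trans (Set.indicator_le_self' (f := fun _ => (1 : ℝ))
      (fun _ _ => zero_le_one) x)
  have hgmass : ENNReal.ofReal (mass g) ≤ volume S := by
    refine ENNReal.ofReal_le_of_le_toReal ?_
    calc mass g ≤ ∫ x, S.indicator (fun _ => (1 : ℝ)) x :=
          integral_mono hgu.integrable.norm hSi hgn
      _ = (volume S).toReal := by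
          rw [integral_indicator_const _ hSm, smul_eq_mul, mul_one]; rfl
  obtain ⟨-, h2⟩ := integrable_layer_prod hk hα hα1 hf hfin hgu.integrable
  have hform : form k f g = ∫ x in S, (‖T x‖ : ℂ) := by
    unfold form
    rw [integral_prod_symm _ h2, ← integral_indicator hSm]
    refine integral_congr_ae ?_
    filter_upwards [hTT'] with x hx
    have e1 : ∫ y, f y * g x * k (x - y) = g x * T x := by
      rw [hT, conv_apply, ← integral_const_mul]
      congr 1; ext y; ring
    rw [e1]
    by_cases hxS : x ∈ S
    · rw [hg, Set.indicator_of_mem hxS, Set.indicator_of_mem hxS, ← hx, div_mul_eq_mul_div,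
        Complex.conj_mul']
      rcases eq_or_ne (‖T x‖ : ℂ) 0 with h0 | h0
      · simp [h0]
      · field_simp
    · rw [hg, Set.indicator_of_notMem hxS, Set.indicator_of_notMem hxS, zero_mul]
  have hTi : IntegrableOn T S := by
    have : IsFiniteMeasure (volume.restrict S) := ⟨by
      rw [Measure.restrict_apply_univ]; exact hSfin⟩
    exact Integrable.of_bound hmeas.restrict M.toReal (Filter.Eventually.of_forall hbdd)
  have hlow : ENNReal.ofReal u * volume S ≤ ‖form k f g‖ₑ := by
    rw [hform, integral_complex_ofReal, ← ofReal_norm, Complex.norm_real,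
      Real.norm_of_nonneg (integral_nonneg fun _ => norm_nonneg _),
      ofReal_integral_norm_eq_lintegral_enorm hTi, ← setLIntegral_const]
    refine lintegral_mono_ae ?_
    filter_upwards [ae_restrict_of_ae hTT', ae_restrict_mem hSm] with x hx hxS
    rw [← ofReal_norm, hx]
    exact ENNReal.ofReal_le_ofReal (le_of_lt (hSsub hxS))
  refine hlow.trans ((hk.enorm_form_le_layerInt hα0 hα hα1 hK hf hfin hgu).trans ?_)
  gcongr
  exact layerInt_mono _ (hα0.le.trans hα) hα0.le hgmass

/-- Convolution with a restricted kernel, tested on superlevel sets. -/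
theorem RestrictedKernel.conv_bound (hk : RestrictedKernel k α' α K) (hα0 : 0 < α)
    (hα : α ≤ α') (hα1 : α' ≤ 1) (hK : K ≠ ⊤)
    (hf : AEStronglyMeasurable f volume) (hfin : layerInt (distribution f) α' α 1 < ⊤) :
    ConvolutionExists f k (ContinuousLinearMap.mul ℂ ℂ) volume ∧
    AEStronglyMeasurable (conv f k) volume ∧
    ∀ u : ℝ, 0 < u → ∀ c < distribution (conv f k) u, ∃ m, c < m ∧ m < ⊤ ∧
      ENNReal.ofReal u * m ≤ K * layerInt (distribution f) α' α m := by
  have hae : f =ᵐ[volume] hf.mk f := hf.ae_eq_mk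
  have hd := distribution_congr hae
  have hae' : ∀ x : E d, (fun y => f y * k (x - y)) =ᵐ[volume] fun y => hf.mk f y * k (x - y) :=
    fun x => by filter_upwards [hae] with y hy; rw [hy]
  have hconv : conv f k = conv (hf.mk f) k := by
    ext x
    rw [conv_apply, conv_apply]
    exact integral_congr_ae (hae' x)
  rw [hd] at hfin
  obtain ⟨h1, h2, h3⟩ := hk.conv_bound_of_measurable hα0 hα hα1 hK
    hf.stronglyMeasurable_mk.measurable hfin
  rw [hconv, hd]
  exact ⟨fun x => (h1 x).congr (hae' x).symm, h2, h3⟩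

end

/-! ### Powers of two and geometric weights. -/

/-- Real powers of `2` in `ℝ≥0∞`. -/
def twoPow (x : ℝ) : ℝ≥0∞ := 2 ^ x

lemma twoPow_add (x y : ℝ) : twoPow (x + y) = twoPow x * twoPow y :=
  ENNReal.rpow_add x y (by norm_num) (by norm_num)

lemma twoPow_rpow (x y : ℝ) : twoPow x ^ y = twoPow (x * y) := (ENNReal.rpow_mul _ _ _).symm

lemma twoPow_zero : twoPow 0 = 1 := ENNReal.rpow_zero

lemma twoPow_one : twoPow 1 = 2 := ENNReal.rpow_one _

lemma twoPow_pos (x : ℝ) : 0 < twoPow x := ENNReal.rpow_pos (by norm_num) (by norm_num)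

lemma twoPow_ne_top (x : ℝ) : twoPow x ≠ ⊤ := ENNReal.rpow_ne_top_of_ne_zero (by norm_num) (by norm_num)

lemma twoPow_mono : Monotone twoPow := fun _ _ h =>
  ENNReal.rpow_le_rpow_of_exponent_le (by norm_num) h

lemma twoPow_strictMono : StrictMono twoPow := fun _ _ h =>
  ENNReal.rpow_lt_rpow_of_exponent_lt (by norm_num) (by norm_num) h

lemma exists_twoPow_lt_le {x : ℝ≥0∞} (h0 : x ≠ 0) (h1 : x ≠ ⊤) :
    ∃ n : ℤ, twoPow n < x ∧ x ≤ twoPow (n + 1) := by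
  obtain ⟨n, hn1, hn2⟩ := ENNReal.exists_mem_Ioc_zpow h0 h1 (y := 2) (by norm_num) (by norm_num)
  refine ⟨n, ?_, ?_⟩
  · unfold twoPow; rwa [ENNReal.rpow_intCast]
  · unfold twoPow
    rw [show ((n : ℝ) + 1) = ((n + 1 : ℤ) : ℝ) by push_cast; rfl, ENNReal.rpow_intCast]
    exact hn2

/-- Handles infinite values in the dyadic arguments: unbounded dyadic multiples of a nonzero
quantity force an infinite bound. -/
lemma iSup_twoPow_mul_eq_top {θ : ℝ} (hθ : 0 < θ) {c M : ℝ≥0∞} (hc : c ≠ 0)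
    (h : ∀ k : ℤ, twoPow (k * θ) * c ≤ M) : M = ⊤ := by
  by_contra hM
  rcases eq_or_ne c ⊤ with rfl | hc'
  · have := h 0
    rw [ENNReal.mul_top (twoPow_pos _).ne'] at this
    exact hM (top_le_iff.1 this)
  have h2 : M / c ≠ ⊤ := ENNReal.div_ne_top hM hc
  have h3 : ∀ k : ℤ, twoPow (k * θ) ≤ M / c := fun k => by
    rw [ENNReal.le_div_iff_mul_le (Or.inl hc) (Or.inl hc')]; exact h k
  have h4 : M / c ≠ 0 := ((twoPow_pos _).trans_le (h3 0)).ne'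
  obtain ⟨n, -, hn⟩ := exists_twoPow_lt_le h4 h2
  obtain ⟨k, hk⟩ := exists_int_gt (((n : ℝ) + 1) / θ)
  rw [div_lt_iff₀ hθ] at hk
  exact absurd ((h3 k).trans hn) (not_le.2 (twoPow_strictMono hk))

/-- Two-sided geometric weights. -/
def geomWeight (θ : ℝ) (j : ℤ) : ℝ≥0∞ := twoPow (-(θ * |(j : ℝ)|))

/-- The sum of the two-sided geometric weights. -/
def geomSum (θ : ℝ) : ℝ≥0∞ := ∑' j : ℤ, geomWeight θ j

lemma geomWeight_rpow (θ s : ℝ) (j : ℤ) : geomWeight θ j ^ s = geomWeight (θ * s) j := by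
  unfold geomWeight; rw [twoPow_rpow]; congr 1; ring

lemma geomWeight_half_mul (θ : ℝ) (j : ℤ) :
    geomWeight (θ / 2) j * geomWeight (θ / 2) j = geomWeight θ j := by
  unfold geomWeight; rw [← twoPow_add]; congr 1; ring

lemma geomWeight_le_one {θ : ℝ} (hθ : 0 ≤ θ) (j : ℤ) : geomWeight θ j ≤ 1 := by
  unfold geomWeight; rw [← twoPow_zero]
  refine twoPow_mono ?_
  have : 0 ≤ θ * |(j : ℝ)| := by positivity
  linarith

lemma geomSum_ne_zero (θ : ℝ) : geomSum θ ≠ 0 := by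
  have : geomWeight θ 0 ≤ geomSum θ := ENNReal.le_tsum 0
  have h : 0 < geomWeight θ 0 := twoPow_pos _
  exact (h.trans_le this).ne'

lemma geomSum_ne_top {θ : ℝ} (hθ : 0 < θ) : geomSum θ ≠ ⊤ := by
  have hn : ∀ n : ℕ, geomWeight θ n = twoPow (-θ) ^ n := by
    intro n
    unfold geomWeight
    rw [← ENNReal.rpow_natCast, twoPow_rpow]; congr 1; simp
  have hr : twoPow (-θ) < 1 := by
    rw [← twoPow_zero]; exact twoPow_strictMono (by linarith)
  have hs : ∑' n : ℕ, twoPow (-θ) ^ n ≠ ⊤ := by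
    rw [ENNReal.tsum_geometric]
    exact ENNReal.inv_ne_top.2 (tsub_pos_of_lt hr).ne'
  have h1 : HasSum (fun n : ℕ => geomWeight θ n) (∑' n : ℕ, geomWeight θ n) :=
    ENNReal.summable.hasSum
  have h2 : HasSum (fun n : ℕ => geomWeight θ (-(n + 1 : ℤ)))
      (∑' n : ℕ, geomWeight θ (-(n + 1 : ℤ))) := ENNReal.summable.hasSum
  have h3 := (HasSum.of_nat_of_neg_add_one h1 h2).tsum_eq
  unfold geomSum
  rw [h3]
  refine ENNReal.add_ne_top.2 ⟨by simpa only [hn] using hs, ?_⟩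
  refine ne_top_of_le_ne_top hs (ENNReal.tsum_le_tsum fun n => ?_)
  rw [← hn]
  unfold geomWeight
  refine twoPow_mono ?_
  push_cast
  rw [abs_neg, abs_of_nonneg (by positivity), abs_of_nonneg (by positivity)]
  nlinarith

lemma tsum_geomWeight_sub_left (θ : ℝ) (j : ℤ) : ∑' k : ℤ, geomWeight θ (j - k) = geomSum θ :=
  (Equiv.subLeft j).tsum_eq (geomWeight θ)

lemma tsum_geomWeight_sub_right (θ : ℝ) (j : ℤ) : ∑' k : ℤ, geomWeight θ (k - j) = geomSum θ :=
  (Equiv.subRight j).tsum_eq (geomWeight θ)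

/-- A geometric sum is comparable to its largest term. With `rpow_le_tsum_twoPow_lt` this replaces
`x ^ θ` by a dyadic sum, up to constants. -/
lemma tsum_twoPow_lt_le {θ : ℝ} (hθ : 0 < θ) (x : ℝ≥0∞) :
    ∑' k : ℤ, (if twoPow k < x then twoPow (k * θ) else 0) ≤ geomSum θ * x ^ θ := by
  rcases eq_or_ne x 0 with rfl | h0
  · simp
  rcases eq_or_ne x ⊤ with rfl | h1
  · rw [ENNReal.top_rpow_of_pos hθ, ENNReal.mul_top (geomSum_ne_zero θ)]; exact le_top
  obtain ⟨n, hn1, hn2⟩ := exists_twoPow_lt_le h0 h1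
  calc ∑' k : ℤ, (if twoPow k < x then twoPow (k * θ) else 0)
      ≤ ∑' k : ℤ, geomWeight θ (k - n) * twoPow (n * θ) := by
        refine ENNReal.tsum_le_tsum fun k => ?_
        split_ifs with hk
        · have h2 := twoPow_strictMono.lt_iff_lt.1 (hk.trans_le hn2)
          have h3 : k ≤ n := by
            have : k < n + 1 := by exact_mod_cast h2
            omega
          unfold geomWeight
          rw [← twoPow_add]
          refine twoPow_mono (le_of_eq ?_)
          have h4 : ((k - n : ℤ) : ℝ) ≤ 0 := by exact_mod_cast Int.sub_nonpos_of_le h3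
          rw [abs_of_nonpos h4]; push_cast; ring
        · exact zero_le
    _ = geomSum θ * twoPow (n * θ) := by
        rw [ENNReal.tsum_mul_right, tsum_geomWeight_sub_right]
    _ ≤ geomSum θ * x ^ θ := by
        gcongr
        rw [← twoPow_rpow]
        exact ENNReal.rpow_le_rpow hn1.le hθ.le

lemma rpow_le_tsum_twoPow_lt {θ : ℝ} (hθ : 0 < θ) (x : ℝ≥0∞) :
    x ^ θ ≤ twoPow θ * ∑' k : ℤ, (if twoPow k < x then twoPow (k * θ) else 0) := by
  rcases eq_or_ne x 0 with rfl | h0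
  · simp [hθ]
  rcases eq_or_ne x ⊤ with rfl | h1
  · have : ∑' k : ℤ, (if twoPow k < (⊤ : ℝ≥0∞) then twoPow (k * θ) else 0) = ⊤ := by
      refine iSup_twoPow_mul_eq_top hθ one_ne_zero fun k => ?_
      rw [mul_one]
      refine le_trans (le_of_eq ?_) (ENNReal.le_tsum k)
      rw [if_pos (twoPow_ne_top _).lt_top]
    rw [this, ENNReal.mul_top (twoPow_pos _).ne']; exact le_top
  obtain ⟨n, hn1, hn2⟩ := exists_twoPow_lt_le h0 h1
  calc x ^ θ ≤ twoPow (n + 1) ^ θ := ENNReal.rpow_le_rpow hn2 hθ.le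
    _ = twoPow θ * twoPow (n * θ) := by rw [twoPow_rpow, ← twoPow_add]; congr 1; ring
    _ ≤ _ := by
        gcongr
        refine le_trans (le_of_eq ?_) (ENNReal.le_tsum n)
        rw [if_pos hn1]

/-! ### Dyadic form of the Lorentz norm; `dyadicLevel l k` is the value of the decreasing
rearrangement at `2^k`. -/

/-- The lengths of the dyadic superlevel sets of `l`. -/
def dyadicLevel (l : ℝ → ℝ≥0∞) (k : ℤ) : ℝ≥0∞ := volume {t : ℝ | 0 < t ∧ twoPow k < l t}

section

variable {l : ℝ → ℝ≥0∞} (hl : Antitone l)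

include hl

lemma measurableSet_dyadic (k : ℤ) : MeasurableSet {t : ℝ | 0 < t ∧ twoPow k < l t} :=
  measurableSet_Ioi.inter (measurableSet_lt measurable_const hl.measurable)

lemma twoPow_lt_of_lt_dyadicLevel {k : ℤ} {t : ℝ} (h : ENNReal.ofReal t < dyadicLevel l k) :
    twoPow k < l t := by
  by_contra hk
  refine absurd h (not_lt.2 ?_)
  calc dyadicLevel l k ≤ volume (Set.Ioo 0 t) := by
        refine measure_mono fun u hu => ⟨hu.1, ?_⟩
        by_contra htu
        exact hk (hu.2.trans_le (hl (not_lt.1 htu)))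
    _ = ENNReal.ofReal t := by rw [Real.volume_Ioo, sub_zero]

lemma le_dyadicLevel {k : ℤ} {t : ℝ} (h : twoPow k < l t) :
    ENNReal.ofReal t ≤ dyadicLevel l k := by
  calc ENNReal.ofReal t = volume (Set.Ioc 0 t) := by rw [Real.volume_Ioc, sub_zero]
    _ ≤ dyadicLevel l k := measure_mono fun u hu => ⟨hu.1, h.trans_le (hl hu.2)⟩

end

lemma setLIntegral_Ioc_rpow_div {s : ℝ} (hs : 0 < s) {a : ℝ} (ha : 0 ≤ a) :
    ∫⁻ t in Set.Ioc 0 a, ENNReal.ofReal t ^ s / ENNReal.ofReal t =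
      ENNReal.ofReal a ^ s / ENNReal.ofReal s := by
  have h1 : ∫⁻ t in Set.Ioc 0 a, ENNReal.ofReal t ^ s / ENNReal.ofReal t =
      ∫⁻ t in Set.Ioc 0 a, ENNReal.ofReal (t ^ (s - 1)) := by
    refine setLIntegral_congr_fun measurableSet_Ioc fun t ht => ?_
    rw [ENNReal.ofReal_rpow_of_pos ht.1, ← ENNReal.ofReal_div_of_pos ht.1, Real.rpow_sub_one ht.1.ne']
  have hi : IntegrableOn (fun t : ℝ => t ^ (s - 1)) (Set.Ioc 0 a) := by
    rw [← intervalIntegrable_iff_integrableOn_Ioc_of_le ha]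
    exact intervalIntegral.intervalIntegrable_rpow' (by linarith)
  rw [h1, ← ofReal_integral_eq_lintegral_ofReal hi, ← intervalIntegral.integral_of_le ha,
    integral_rpow (Or.inl (by linarith))]
  · rw [sub_add_cancel, Real.zero_rpow hs.ne', sub_zero, ENNReal.ofReal_div_of_pos hs,
      ENNReal.ofReal_rpow_of_nonneg ha hs.le]
  · filter_upwards [ae_restrict_mem measurableSet_Ioc] with t ht
    exact Real.rpow_nonneg ht.1.le _

/-- For antitone `l` the set is an interval starting at `0` of length `dyadicLevel l k`, up to its
right endpoint. -/
lemma setLIntegral_dyadic {l : ℝ → ℝ≥0∞} (hl : Antitone l) {s : ℝ} (hs : 0 < s) (k : ℤ) :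
    ∫⁻ t in {t : ℝ | 0 < t ∧ twoPow k < l t}, ENNReal.ofReal t ^ s / ENNReal.ofReal t =
      dyadicLevel l k ^ s / ENNReal.ofReal s := by
  have hs' : ENNReal.ofReal s ≠ 0 := by simpa using hs
  rcases eq_or_ne (dyadicLevel l k) ⊤ with h | h
  · rw [h, ENNReal.top_rpow_of_pos hs, ENNReal.top_div_of_ne_top ENNReal.ofReal_ne_top]
    refine ENNReal.eq_top_of_forall_nnreal_le fun r => ?_
    set a : ℝ := (r * s) ^ (1 / s) with ha
    have ha0 : 0 ≤ a := by positivity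
    have has : a ^ s = r * s := by
      rw [ha, ← Real.rpow_mul (by positivity), one_div_mul_cancel hs.ne', Real.rpow_one]
    calc (r : ℝ≥0∞) = ENNReal.ofReal a ^ s / ENNReal.ofReal s := by
          rw [ENNReal.ofReal_rpow_of_nonneg ha0 hs.le, has, ← ENNReal.ofReal_div_of_pos hs,
            mul_div_cancel_right₀ _ hs.ne', ENNReal.ofReal_coe_nnreal]
      _ = _ := (setLIntegral_Ioc_rpow_div hs ha0).symm
      _ ≤ _ := lintegral_mono_set (show Set.Ioc 0 a ⊆ {t : ℝ | 0 < t ∧ twoPow k < l t} from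
          fun t ht =>
            ⟨ht.1, twoPow_lt_of_lt_dyadicLevel hl (by rw [h]; exact ENNReal.ofReal_lt_top)⟩)
  · set a := (dyadicLevel l k).toReal with ha
    have hae : dyadicLevel l k = ENNReal.ofReal a := (ENNReal.ofReal_toReal h).symm
    have ha0 : 0 ≤ a := ENNReal.toReal_nonneg
    rw [hae, ← setLIntegral_Ioc_rpow_div hs ha0]
    refine le_antisymm (lintegral_mono_set fun t ht => ⟨ht.1, ?_⟩) ?_
    · have := le_dyadicLevel hl ht.2
      rw [hae] at this
      exact (ENNReal.ofReal_le_ofReal_iff ha0).1 this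
    · rw [← setLIntegral_congr Ioo_ae_eq_Ioc]
      refine lintegral_mono_set fun t ht => ⟨ht.1, twoPow_lt_of_lt_dyadicLevel hl ?_⟩
      rw [hae]
      exact (ENNReal.ofReal_lt_ofReal_iff (ht.1.trans ht.2)).2 ht.2

lemma lintegral_comp_le_tsum {l : ℝ → ℝ≥0∞} (hl : Antitone l) (hfin : ∀ t, 0 < t → l t ≠ ⊤)
    {φ : ℝ≥0∞ → ℝ≥0∞} (hφ : Monotone φ) (hφ0 : φ 0 = 0) :
    ∫⁻ t in Set.Ioi (0 : ℝ), φ (l t) ≤ ∑' k : ℤ, φ (twoPow (k + 1)) * dyadicLevel l k := by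
  calc ∫⁻ t in Set.Ioi (0 : ℝ), φ (l t)
      ≤ ∫⁻ t in Set.Ioi (0 : ℝ), ∑' k : ℤ,
          {t : ℝ | 0 < t ∧ twoPow k < l t}.indicator (fun _ => φ (twoPow (k + 1))) t := by
        refine setLIntegral_mono' measurableSet_Ioi fun t ht => ?_
        rcases eq_or_ne (l t) 0 with h0 | h0
        · rw [h0, hφ0]; exact zero_le
        obtain ⟨n, hn1, hn2⟩ := exists_twoPow_lt_le h0 (hfin t ht)
        refine le_trans ?_ (ENNReal.le_tsum n)
        rw [Set.indicator_of_mem (show t ∈ {t : ℝ | 0 < t ∧ twoPow n < l t} from ⟨ht, hn1⟩)]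
        exact hφ hn2
    _ = ∑' k : ℤ, φ (twoPow (k + 1)) * dyadicLevel l k := by
        rw [lintegral_tsum fun k =>
          (measurable_const.indicator (measurableSet_dyadic hl k)).aemeasurable]
        congr 1; ext k
        rw [lintegral_indicator_const (measurableSet_dyadic hl k),
          Measure.restrict_apply (measurableSet_dyadic hl k)]
        congr 2
        ext t
        exact ⟨fun h => h.1, fun h => ⟨h, h.1⟩⟩

/-- The Lorentz functional of a distribution function. -/
def lorentzOf (l : ℝ → ℝ≥0∞) (p : ℝ) (s : ℝ≥0∞) : ℝ≥0∞ :=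
  if s = ∞ then
    ⨆ t : Set.Ioi (0 : ℝ), ENNReal.ofReal t * l t ^ (1 / p)
  else
    ENNReal.ofReal p ^ (1 / s.toReal) *
      (∫⁻ t in Set.Ioi (0 : ℝ),
        (ENNReal.ofReal t * l t ^ (1 / p)) ^ s.toReal / ENNReal.ofReal t)
          ^ (1 / s.toReal)

lemma lorentzNorm_eq {d : ℕ} (f : E d → ℂ) (p : ℝ) (s : ℝ≥0∞) :
    lorentzNorm f p s = lorentzOf (distribution f) p s := rfl

/-- The dyadic sequence attached to `L^{p,s}`. -/
def dyadicSeq (l : ℝ → ℝ≥0∞) (θ : ℝ) (k : ℤ) : ℝ≥0∞ := twoPow (k * θ) * dyadicLevel l k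

lemma tsum_mul_setLIntegral_dyadic {l : ℝ → ℝ≥0∞} (hl : Antitone l) {s : ℝ} (θ : ℝ) :
    ∑' k : ℤ, twoPow (k * θ) *
        ∫⁻ t in {t : ℝ | 0 < t ∧ twoPow k < l t}, ENNReal.ofReal t ^ s / ENNReal.ofReal t =
      ∫⁻ t in Set.Ioi (0 : ℝ), (ENNReal.ofReal t ^ s / ENNReal.ofReal t) *
        ∑' k : ℤ, (if twoPow k < l t then twoPow (k * θ) else 0) := by
  have hm : Measurable fun t : ℝ => ENNReal.ofReal t ^ s / ENNReal.ofReal t := by fun_prop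
  have h1 : ∀ k : ℤ, twoPow (k * θ) *
        ∫⁻ t in {t : ℝ | 0 < t ∧ twoPow k < l t}, ENNReal.ofReal t ^ s / ENNReal.ofReal t =
      ∫⁻ t in Set.Ioi (0 : ℝ), (ENNReal.ofReal t ^ s / ENNReal.ofReal t) *
        (if twoPow k < l t then twoPow (k * θ) else 0) := by
    intro k
    rw [← lintegral_const_mul' _ _ (twoPow_ne_top _),
      ← lintegral_indicator (measurableSet_dyadic hl k), ← lintegral_indicator measurableSet_Ioi]
    refine lintegral_congr fun t => ?_
    by_cases ht : 0 < t <;> by_cases hk : twoPow k < l t <;> simp [Set.indicator, ht, hk, mul_comm]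
  simp_rw [h1, ← ENNReal.tsum_mul_left]
  rw [lintegral_tsum]
  intro k
  refine (hm.mul (Measurable.ite ?_ measurable_const measurable_const)).aemeasurable
  exact measurableSet_lt measurable_const hl.measurable

lemma rpow_dyadicSeq {l : ℝ → ℝ≥0∞} (hl : Antitone l) {s : ℝ} (hs : 0 < s) (θ : ℝ) (k : ℤ) :
    dyadicSeq l θ k ^ s = ENNReal.ofReal s * (twoPow (k * (θ * s)) *
      ∫⁻ t in {t : ℝ | 0 < t ∧ twoPow k < l t}, ENNReal.ofReal t ^ s / ENNReal.ofReal t) := by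
  have hs' : ENNReal.ofReal s ≠ 0 := by simpa using hs
  unfold dyadicSeq
  rw [setLIntegral_dyadic hl hs, ENNReal.mul_rpow_of_nonneg _ _ hs.le, twoPow_rpow, mul_left_comm,
    ENNReal.mul_div_cancel hs' ENNReal.ofReal_ne_top, mul_assoc]

lemma lorentz_integrand_eq {l : ℝ → ℝ≥0∞} {s : ℝ} (hs : 0 < s) (θ t : ℝ) :
    (ENNReal.ofReal t * l t ^ θ) ^ s / ENNReal.ofReal t =
      (ENNReal.ofReal t ^ s / ENNReal.ofReal t) * l t ^ (θ * s) := by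
  rw [ENNReal.mul_rpow_of_nonneg _ _ hs.le, ← ENNReal.rpow_mul, ENNReal.mul_div_right_comm]

/-- Expanding `l t ^ (θ s)` as a dyadic sum and exchanging sum and integral shows, together with the
converse inequality below, that the Lorentz integral is comparable to the `ℓ^s` sum of `dyadicSeq`.
-/
lemma tsum_rpow_dyadicSeq_le {l : ℝ → ℝ≥0∞} (hl : Antitone l) {s θ : ℝ} (hs : 0 < s)
    (hθ : 0 < θ) :
    ∑' k : ℤ, dyadicSeq l θ k ^ s ≤ ENNReal.ofReal s * geomSum (θ * s) *
      ∫⁻ t in Set.Ioi (0 : ℝ), (ENNReal.ofReal t * l t ^ θ) ^ s / ENNReal.ofReal t := by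
  simp_rw [rpow_dyadicSeq hl hs, lorentz_integrand_eq hs]
  rw [ENNReal.tsum_mul_left, tsum_mul_setLIntegral_dyadic hl, mul_assoc,
    ← lintegral_const_mul' _ _ (geomSum_ne_top (mul_pos hθ hs))]
  refine mul_le_mul_right (lintegral_mono fun t => ?_) _
  rw [mul_left_comm]
  refine mul_le_mul_right ?_ _
  exact tsum_twoPow_lt_le (mul_pos hθ hs) _

lemma lintegral_le_tsum_rpow_dyadicSeq {l : ℝ → ℝ≥0∞} (hl : Antitone l) {s θ : ℝ} (hs : 0 < s)
    (hθ : 0 < θ) :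
    ∫⁻ t in Set.Ioi (0 : ℝ), (ENNReal.ofReal t * l t ^ θ) ^ s / ENNReal.ofReal t ≤
      twoPow (θ * s) / ENNReal.ofReal s * ∑' k : ℤ, dyadicSeq l θ k ^ s := by
  have hs' : ENNReal.ofReal s ≠ 0 := by simpa using hs
  simp_rw [rpow_dyadicSeq hl hs, lorentz_integrand_eq hs]
  rw [ENNReal.tsum_mul_left, tsum_mul_setLIntegral_dyadic hl, ← mul_assoc,
    ENNReal.div_mul_cancel hs' ENNReal.ofReal_ne_top,
    ← lintegral_const_mul' _ _ (twoPow_ne_top _)]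
  refine lintegral_mono fun t => ?_
  rw [mul_left_comm]
  refine mul_le_mul_right ?_ _
  exact rpow_le_tsum_twoPow_lt (mul_pos hθ hs) _

lemma dyadicSeq_le_of_forall {l : ℝ → ℝ≥0∞} (hl : Antitone l) {θ : ℝ} (k : ℤ) {M : ℝ≥0∞}
    (h : ∀ t, 0 < t → twoPow k < l t → twoPow (k * θ) * ENNReal.ofReal t ≤ M) :
    dyadicSeq l θ k ≤ M := by
  unfold dyadicSeq
  have h0 := (twoPow_pos (k * θ)).ne'
  have h1 := twoPow_ne_top (k * θ)
  rw [mul_comm, ← ENNReal.le_div_iff_mul_le (Or.inl h0) (Or.inl h1)]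
  refine le_of_forall_lt fun c hc => ?_
  obtain ⟨c', hcc', hc'⟩ := exists_between hc
  refine hcc'.trans_le ?_
  have hc't : c' ≠ ⊤ := (hc'.trans_le le_top).ne
  rw [ENNReal.le_div_iff_mul_le (Or.inl h0) (Or.inl h1), mul_comm]
  have hc'0 : 0 < c'.toReal := ENNReal.toReal_pos (zero_le.trans_lt hcc').ne' hc't
  rw [← ENNReal.ofReal_toReal hc't] at hc' ⊢
  exact h _ hc'0 (twoPow_lt_of_lt_dyadicLevel hl hc')

lemma dyadicSeq_le_lorentzOf_top {l : ℝ → ℝ≥0∞} (hl : Antitone l) {p : ℝ} (hp : 0 < 1 / p)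
    (k : ℤ) : dyadicSeq l (1 / p) k ≤ lorentzOf l p ⊤ := by
  refine dyadicSeq_le_of_forall hl k fun t ht hk => ?_
  unfold lorentzOf
  rw [if_pos rfl]
  refine le_trans ?_ (le_iSup (fun t : Set.Ioi (0 : ℝ) => ENNReal.ofReal t * l t ^ (1 / p)) ⟨t, ht⟩)
  rw [mul_comm, ← twoPow_rpow]
  simp only
  gcongr

lemma lorentzOf_top_le {l : ℝ → ℝ≥0∞} (hl : Antitone l) {p : ℝ} (hp : 0 < 1 / p) :
    lorentzOf l p ⊤ ≤ twoPow (1 / p) * ⨆ k, dyadicSeq l (1 / p) k := by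
  unfold lorentzOf
  rw [if_pos rfl]
  refine iSup_le fun ⟨t, ht⟩ => ?_
  simp only
  have ht0 : ENNReal.ofReal t ≠ 0 := by simpa using ht
  have key : ∀ k : ℤ, twoPow k < l t →
      twoPow (k * (1 / p)) * ENNReal.ofReal t ≤ ⨆ k, dyadicSeq l (1 / p) k := fun k hk =>
    le_trans (by unfold dyadicSeq; gcongr; exact le_dyadicLevel hl hk)
      (le_iSup (dyadicSeq l (1 / p)) k)
  rcases eq_or_ne (l t) 0 with h0 | h0
  · rw [h0, ENNReal.zero_rpow_of_pos hp, mul_zero]; exact zero_le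
  rcases eq_or_ne (l t) ⊤ with h1 | h1
  · have : ⨆ k, dyadicSeq l (1 / p) k = ⊤ :=
      iSup_twoPow_mul_eq_top hp ht0 fun k => key k (by rw [h1]; exact (twoPow_ne_top _).lt_top)
    rw [this, ENNReal.mul_top (twoPow_pos _).ne']; exact le_top
  · obtain ⟨n, hn1, hn2⟩ := exists_twoPow_lt_le h0 h1
    calc ENNReal.ofReal t * l t ^ (1 / p) ≤ ENNReal.ofReal t * twoPow (n + 1) ^ (1 / p) := by
          gcongr
      _ = twoPow (1 / p) * (twoPow (n * (1 / p)) * ENNReal.ofReal t) := by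
          rw [twoPow_rpow, add_mul, one_mul, twoPow_add]; ring
      _ ≤ _ := by gcongr; exact key n hn1

lemma exists_dyadicSeq_le_of_lorentzOf {l : ℝ → ℝ≥0∞} (hl : Antitone l) {p : ℝ} (hp : 0 < p)
    {s : ℝ≥0∞} (hs : 0 < s) (hfin : lorentzOf l p s < ⊤) :
    ∃ M : ℝ≥0∞, M ≠ ⊤ ∧ ∀ k, dyadicSeq l (1 / p) k ≤ M := by
  have hp' : 0 < 1 / p := by positivity
  rcases eq_or_ne s ⊤ with rfl | hst
  · exact ⟨_, hfin.ne, dyadicSeq_le_lorentzOf_top hl hp'⟩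
  have hs0 : 0 < s.toReal := ENNReal.toReal_pos hs.ne' hst
  unfold lorentzOf at hfin
  rw [if_neg hst] at hfin
  have hp0 : ENNReal.ofReal p ^ (1 / s.toReal) ≠ 0 := by
    have : ENNReal.ofReal p ≠ 0 := by simpa using hp
    simp [this]
  have h1 := ENNReal.lt_top_of_mul_ne_top_right hfin.ne hp0
  rw [ENNReal.rpow_lt_top_iff_of_pos (by positivity)] at h1
  have h2 := tsum_rpow_dyadicSeq_le hl hs0 hp'
  set I := ∫⁻ t in Set.Ioi (0 : ℝ),
    (ENNReal.ofReal t * l t ^ (1 / p)) ^ s.toReal / ENNReal.ofReal t with hI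
  set M := ENNReal.ofReal s.toReal * geomSum (1 / p * s.toReal) * I with hM
  have hMt : M ≠ ⊤ := ENNReal.mul_ne_top (ENNReal.mul_ne_top ENNReal.ofReal_ne_top
    (geomSum_ne_top (by positivity))) h1.ne
  refine ⟨M ^ (1 / s.toReal), ENNReal.rpow_ne_top_of_nonneg (by positivity) hMt, fun k => ?_⟩
  rw [one_div s.toReal, ENNReal.le_rpow_inv_iff hs0]
  exact (ENNReal.le_tsum k).trans h2

lemma ne_top_of_dyadicSeq_le {l : ℝ → ℝ≥0∞} (hl : Antitone l) {θ : ℝ} (hθ : 0 < θ) {M : ℝ≥0∞}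
    (hM : M ≠ ⊤) (h : ∀ k, dyadicSeq l θ k ≤ M) (t : ℝ) (ht : 0 < t) : l t ≠ ⊤ := by
  intro h1
  refine hM (iSup_twoPow_mul_eq_top hθ (c := ENNReal.ofReal t) (by simpa using ht) fun k => ?_)
  refine le_trans ?_ (h k)
  unfold dyadicSeq
  gcongr
  exact le_dyadicLevel hl (by rw [h1]; exact (twoPow_ne_top _).lt_top)

/-! ### Marcinkiewicz interpolation on dyadic sequences. -/

section

variable {l L : ℝ → ℝ≥0∞} {α' α θ η ε : ℝ} {K : ℝ≥0∞}

/-- For `j ≤ k` the first term of the minimum is used, for `j ≥ k` the second; as `θ` keeps distance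
`ε` from both exponents, each choice gains `2^{-ε|j-k|}`. Only `m ≥ 2^k` is needed, since `m^β ≤
2^{k(β-1)} m` for `β ≤ 1`. The factor `2` pays for `j + 1` in place of `j`. -/
lemma twoPow_mul_layerInt_le (hl : Antitone l) (hfin : ∀ t, 0 < t → l t ≠ ⊤) (hα : 0 < α)
    (hα1 : α ≤ 1) (hα' : 0 < α') (hα'1 : α' ≤ 1) (h1 : α + ε ≤ θ) (h2 : θ + ε ≤ α')
    (hη : η = θ - (α + α' - 1)) {k : ℤ} {m : ℝ≥0∞} (hkm : twoPow k ≤ m) (hm : m ≠ ⊤) :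
    twoPow (k * η) * layerInt l α' α m ≤
      2 * (∑' j : ℤ, dyadicSeq l θ j * geomWeight ε (j - k)) * m := by
  have hm0 : m ≠ 0 := ((twoPow_pos _).trans_le hkm).ne'
  have hpow : ∀ β : ℝ, β ≤ 1 → m ^ β ≤ twoPow (k * (β - 1)) * m := by
    intro β hβ
    calc m ^ β = m ^ (β - 1) * m := by
          conv_rhs => rw [← ENNReal.rpow_one m, ← ENNReal.rpow_mul, one_mul]
          rw [← ENNReal.rpow_add _ _ hm0 hm, sub_add_cancel]
      _ ≤ _ := by
          gcongr
          rw [← twoPow_rpow, ← neg_sub 1 β, ENNReal.rpow_neg, ENNReal.rpow_neg, ENNReal.inv_le_inv]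
          exact ENNReal.rpow_le_rpow hkm (by linarith)
  have h3 : layerInt l α' α m ≤ ∑' j : ℤ,
      min (twoPow (j + 1) ^ α' * m ^ α) (twoPow (j + 1) ^ α * m ^ α') * dyadicLevel l j := by
    unfold layerInt
    refine lintegral_comp_le_tsum hl hfin (φ := fun x => min (x ^ α' * m ^ α) (x ^ α * m ^ α'))
      ?_ ?_
    · intro x y hxy
      simp only
      gcongr
    · simp [hα, hα']
  calc twoPow (k * η) * layerInt l α' α m ≤ twoPow (k * η) * ∑' j : ℤ,
      min (twoPow (j + 1) ^ α' * m ^ α) (twoPow (j + 1) ^ α * m ^ α') * dyadicLevel l j := by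
        gcongr
    _ = ∑' j : ℤ, twoPow (k * η) *
      (min (twoPow (j + 1) ^ α' * m ^ α) (twoPow (j + 1) ^ α * m ^ α') * dyadicLevel l j) :=
        ENNReal.tsum_mul_left.symm
    _ ≤ ∑' j : ℤ, 2 * (dyadicSeq l θ j * geomWeight ε (j - k)) * m := by
        refine ENNReal.tsum_le_tsum fun j => ?_
        have h4 : twoPow (k * η) *
            min (twoPow (j + 1) ^ α' * m ^ α) (twoPow (j + 1) ^ α * m ^ α') ≤
            2 * (twoPow (j * θ) * geomWeight ε (j - k)) * m := by
          unfold geomWeight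
          rw [← twoPow_one, ← twoPow_add, ← twoPow_add]
          rcases le_total j k with hjk | hjk
          · have hr : (j : ℝ) ≤ k := by exact_mod_cast hjk
            calc _ ≤ twoPow (k * η) * (twoPow (j + 1) ^ α' * (twoPow (k * (α - 1)) * m)) := by
                  gcongr
                  exact (min_le_left _ _).trans (mul_le_mul_right (hpow α hα1) _)
              _ = twoPow (k * η + ((j + 1) * α' + k * (α - 1))) * m := by
                  rw [twoPow_rpow, twoPow_add, twoPow_add]; ring
              _ ≤ _ := by
                  gcongr
                  refine twoPow_mono ?_
                  push_cast
                  rw [abs_of_nonpos (by linarith), hη]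
                  nlinarith
          · have hr : (k : ℝ) ≤ j := by exact_mod_cast hjk
            calc _ ≤ twoPow (k * η) * (twoPow (j + 1) ^ α * (twoPow (k * (α' - 1)) * m)) := by
                  gcongr
                  exact (min_le_right _ _).trans (mul_le_mul_right (hpow α' hα'1) _)
              _ = twoPow (k * η + ((j + 1) * α + k * (α' - 1))) * m := by
                  rw [twoPow_rpow, twoPow_add, twoPow_add]; ring
              _ ≤ _ := by
                  gcongr
                  refine twoPow_mono ?_
                  push_cast
                  rw [abs_of_nonneg (by linarith), hη]
                  nlinarith
        rw [← mul_assoc]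
        calc _ ≤ 2 * (twoPow (j * θ) * geomWeight ε (j - k)) * m * dyadicLevel l j := by gcongr
          _ = _ := by unfold dyadicSeq; ring
    _ = _ := by rw [ENNReal.tsum_mul_right, ENNReal.tsum_mul_left]

lemma layerInt_one_lt_top (hl : Antitone l) (hα : 0 < α) (hα1 : α ≤ 1) (hα'1 : α' ≤ 1)
    (h1 : α < θ) (h2 : θ < α') {M : ℝ≥0∞} (hM : M ≠ ⊤) (h : ∀ k, dyadicSeq l θ k ≤ M) :
    layerInt l α' α 1 < ⊤ := by
  set ε := min (θ - α) (α' - θ) with hεdef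
  have hε : 0 < ε := lt_min (by linarith) (by linarith)
  have hε1 : ε ≤ θ - α := min_le_left _ _
  have hε2 : ε ≤ α' - θ := min_le_right _ _
  have h3 := twoPow_mul_layerInt_le hl (ne_top_of_dyadicSeq_le hl (hα.trans h1) hM h) hα hα1
    (by linarith) hα'1 (θ := θ) (by linarith) (by linarith) rfl (k := 0) (m := 1)
    (by simp [twoPow_zero]) ENNReal.one_ne_top
  simp only [Int.cast_zero, zero_mul, twoPow_zero, one_mul, sub_zero, mul_one] at h3
  refine h3.trans_lt (ENNReal.mul_lt_top (by norm_num) ?_)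
  calc ∑' j : ℤ, dyadicSeq l θ j * geomWeight ε j ≤ ∑' j : ℤ, M * geomWeight ε j := by
        gcongr with j; exact h j
    _ = M * geomSum ε := ENNReal.tsum_mul_left
    _ < ⊤ := ENNReal.mul_lt_top hM.lt_top (geomSum_ne_top hε).lt_top

/-- Half of the geometric decay is spent on summing over `j`, the other half stays inside a
supremum. A supremum, unlike a sum, can be raised to any power `s > 0` termwise, so
`tsum_rpow_iSup_le` needs no distinction between `s < 1` and `s ≥ 1`. -/
lemma dyadicSeq_le_iSup (hl : Antitone l) (hL : Antitone L) (hfin : ∀ t, 0 < t → l t ≠ ⊤)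
    (hα : 0 < α) (hα1 : α ≤ 1) (hα' : 0 < α') (hα'1 : α' ≤ 1) (h1 : α + ε ≤ θ)
    (h2 : θ + ε ≤ α') (hη : η = θ - (α + α' - 1))
    (hW : ∀ u : ℝ, 0 < u → ∀ c < L u, ∃ m, c < m ∧ m < ⊤ ∧
      ENNReal.ofReal u * m ≤ K * layerInt l α' α m) (k : ℤ) :
    dyadicSeq L η k ≤ 2 * geomSum (ε / 2) * K *
      ⨆ j : ℤ, dyadicSeq l θ j * geomWeight (ε / 2) (j - k) := by
  refine dyadicSeq_le_of_forall hL k fun u hu hk => ?_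
  obtain ⟨m, hkm, hm, hle⟩ := hW u hu _ hk
  have hm0 : m ≠ 0 := ((twoPow_pos _).trans hkm).ne'
  refine (ENNReal.mul_le_mul_iff_left hm0 hm.ne).1 ?_
  calc twoPow (k * η) * ENNReal.ofReal u * m
      ≤ twoPow (k * η) * (K * layerInt l α' α m) := by rw [mul_assoc]; gcongr
    _ = K * (twoPow (k * η) * layerInt l α' α m) := by ring
    _ ≤ K * (2 * (∑' j : ℤ, dyadicSeq l θ j * geomWeight ε (j - k)) * m) := by
        exact mul_le_mul_right
          (twoPow_mul_layerInt_le hl hfin hα hα1 hα' hα'1 h1 h2 hη hkm.le hm.ne) _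
    _ ≤ K * (2 * (∑' j : ℤ, (⨆ j : ℤ, dyadicSeq l θ j * geomWeight (ε / 2) (j - k)) *
          geomWeight (ε / 2) (j - k)) * m) := by
        refine mul_le_mul_right (mul_le_mul_left (mul_le_mul_right
          (ENNReal.tsum_le_tsum fun j => ?_) _) _) _
        rw [← geomWeight_half_mul, ← mul_assoc]
        refine mul_le_mul_left ?_ _
        exact le_iSup (fun j : ℤ => dyadicSeq l θ j * geomWeight (ε / 2) (j - k)) j
    _ = _ := by
        rw [ENNReal.tsum_mul_left, tsum_geomWeight_sub_right]; ring

lemma tsum_rpow_iSup_le {s : ℝ} (hs : 0 < s) (x : ℤ → ℝ≥0∞) :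
    ∑' k : ℤ, (⨆ j : ℤ, x j * geomWeight ε (j - k)) ^ s ≤
      geomSum (ε * s) * ∑' j : ℤ, x j ^ s := by
  have h1 : ∀ k : ℤ, (⨆ j : ℤ, x j * geomWeight ε (j - k)) ^ s ≤
      ∑' j : ℤ, x j ^ s * geomWeight (ε * s) (j - k) := by
    intro k
    rw [← ENNReal.le_rpow_inv_iff hs]
    refine iSup_le fun j => ?_
    rw [ENNReal.le_rpow_inv_iff hs, ENNReal.mul_rpow_of_nonneg _ _ hs.le, geomWeight_rpow]
    exact ENNReal.le_tsum (f := fun j : ℤ => x j ^ s * geomWeight (ε * s) (j - k)) j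
  calc _ ≤ ∑' k : ℤ, ∑' j : ℤ, x j ^ s * geomWeight (ε * s) (j - k) := ENNReal.tsum_le_tsum h1
    _ = ∑' j : ℤ, ∑' k : ℤ, x j ^ s * geomWeight (ε * s) (j - k) := ENNReal.tsum_comm
    _ = ∑' j : ℤ, x j ^ s * geomSum (ε * s) := by
        congr 1; ext j
        rw [ENNReal.tsum_mul_left, tsum_geomWeight_sub_left]
    _ = _ := by rw [ENNReal.tsum_mul_right, mul_comm]

/-- Marcinkiewicz interpolation between the two restricted weak type bounds, at the level of
distribution functions. -/
theorem lorentzOf_le_of_layerInt {p q : ℝ} {s : ℝ≥0∞} (hs : 0 < s)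
    (hα : 0 < α) (hα1 : α ≤ 1) (hα'1 : α' ≤ 1) (h1 : α < 1 / p) (h2 : 1 / p < α')
    (hq : 1 / q = 1 / p - (α + α' - 1)) :
    ∃ C : ℝ≥0∞, C ≠ ⊤ ∧ ∀ (l L : ℝ → ℝ≥0∞) (K : ℝ≥0∞), Antitone l → Antitone L →
      lorentzOf l p s < ⊤ →
      (∀ u : ℝ, 0 < u → ∀ c < L u, ∃ m, c < m ∧ m < ⊤ ∧
        ENNReal.ofReal u * m ≤ K * layerInt l α' α m) →
      lorentzOf L q s ≤ C * K * lorentzOf l p s := by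
  have hp' : 0 < 1 / p := hα.trans h1
  have hp : 0 < p := one_div_pos.1 hp'
  have hq' : 0 < 1 / q := by rw [hq]; linarith
  have hq0 : 0 < q := one_div_pos.1 hq'
  set ε := min (1 / p - α) (α' - 1 / p) with hεdef
  have hε : 0 < ε := lt_min (by linarith) (by linarith)
  have hε1 : ε ≤ 1 / p - α := min_le_left _ _
  have hε2 : ε ≤ α' - 1 / p := min_le_right _ _
  have hG := geomSum_ne_top (half_pos hε)
  have main : ∀ (l L : ℝ → ℝ≥0∞) (K : ℝ≥0∞), Antitone l → Antitone L →
      lorentzOf l p s < ⊤ →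
      (∀ u : ℝ, 0 < u → ∀ c < L u, ∃ m, c < m ∧ m < ⊤ ∧
        ENNReal.ofReal u * m ≤ K * layerInt l α' α m) → ∀ k : ℤ,
      dyadicSeq L (1 / q) k ≤ 2 * geomSum (ε / 2) * K *
        ⨆ j : ℤ, dyadicSeq l (1 / p) j * geomWeight (ε / 2) (j - k) := by
    intro l L K hl hL hfin hW k
    obtain ⟨M, hM, hle⟩ := exists_dyadicSeq_le_of_lorentzOf hl hp hs hfin
    exact dyadicSeq_le_iSup hl hL (ne_top_of_dyadicSeq_le hl hp' hM hle) hα hα1 (by linarith) hα'1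
      (by linarith) (by linarith) hq hW k
  rcases eq_or_ne s ⊤ with rfl | hst
  · refine ⟨twoPow (1 / q) * (2 * geomSum (ε / 2)), ENNReal.mul_ne_top (twoPow_ne_top _)
      (ENNReal.mul_ne_top (by norm_num) hG), fun l L K hl hL hfin hW => ?_⟩
    refine (lorentzOf_top_le hL hq').trans ?_
    rw [mul_assoc, mul_assoc (twoPow _)]
    gcongr
    refine iSup_le fun k => (main l L K hl hL hfin hW k).trans ?_
    rw [mul_assoc]
    gcongr
    refine iSup_le fun j => ?_
    calc _ ≤ dyadicSeq l (1 / p) j * 1 := by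
          gcongr; exact geomWeight_le_one (half_pos hε).le _
      _ ≤ _ := by rw [mul_one]; exact dyadicSeq_le_lorentzOf_top hl hp' j
  have hs0 : 0 < s.toReal := ENNReal.toReal_pos hs.ne' hst
  set r := s.toReal with hr
  have hr' : ENNReal.ofReal r ≠ 0 := by simpa using hs0
  have hpr : ENNReal.ofReal p ≠ 0 := by simpa using hp
  set C₁ := twoPow (1 / q * r) / ENNReal.ofReal r * (geomSum (ε / 2 * r) *
    (ENNReal.ofReal r * geomSum (1 / p * r))) with hC₁
  have hC₁t : C₁ ≠ ⊤ := by
    refine ENNReal.mul_ne_top (ENNReal.div_ne_top (twoPow_ne_top _) hr') (ENNReal.mul_ne_top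
      (geomSum_ne_top (by positivity)) (ENNReal.mul_ne_top ENNReal.ofReal_ne_top
      (geomSum_ne_top (by positivity))))
  have hr1 : 0 < 1 / r := by positivity
  refine ⟨ENNReal.ofReal q ^ (1 / r) / ENNReal.ofReal p ^ (1 / r) * C₁ ^ (1 / r) *
    (2 * geomSum (ε / 2)), ?_, fun l L K hl hL hfin hW => ?_⟩
  · refine ENNReal.mul_ne_top (ENNReal.mul_ne_top (ENNReal.div_ne_top ?_ ?_) ?_)
      (ENNReal.mul_ne_top (by norm_num) hG)
    · exact ENNReal.rpow_ne_top_of_nonneg hr1.le ENNReal.ofReal_ne_top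
    · simp [hpr]
    · exact ENNReal.rpow_ne_top_of_nonneg hr1.le hC₁t
  have hb : ∑' k : ℤ, dyadicSeq L (1 / q) k ^ r ≤
      (2 * geomSum (ε / 2) * K) ^ r *
        (geomSum (ε / 2 * r) * ∑' j : ℤ, dyadicSeq l (1 / p) j ^ r) := by
    calc ∑' k : ℤ, dyadicSeq L (1 / q) k ^ r
        ≤ ∑' k : ℤ, (2 * geomSum (ε / 2) * K *
          ⨆ j : ℤ, dyadicSeq l (1 / p) j * geomWeight (ε / 2) (j - k)) ^ r := by
          gcongr with k; exact main l L K hl hL hfin hW k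
      _ = (2 * geomSum (ε / 2) * K) ^ r *
          ∑' k : ℤ, (⨆ j : ℤ, dyadicSeq l (1 / p) j * geomWeight (ε / 2) (j - k)) ^ r := by
          rw [← ENNReal.tsum_mul_left]
          congr 1; ext k
          rw [ENNReal.mul_rpow_of_nonneg _ _ hs0.le]
      _ ≤ _ := by gcongr; exact tsum_rpow_iSup_le hs0 _
  have hI := lintegral_le_tsum_rpow_dyadicSeq hL hs0 hq'
  have hI2 := tsum_rpow_dyadicSeq_le hl hs0 hp'
  unfold lorentzOf
  rw [if_neg hst, if_neg hst, ← hr]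
  set I := ∫⁻ t in Set.Ioi (0 : ℝ), (ENNReal.ofReal t * l t ^ (1 / p)) ^ r / ENNReal.ofReal t
  set J := ∫⁻ t in Set.Ioi (0 : ℝ), (ENNReal.ofReal t * L t ^ (1 / q)) ^ r / ENNReal.ofReal t
  have hJI : J ≤ (2 * geomSum (ε / 2) * K) ^ r * (C₁ * I) := by
    calc J ≤ _ := hI
      _ ≤ twoPow (1 / q * r) / ENNReal.ofReal r * ((2 * geomSum (ε / 2) * K) ^ r *
        (geomSum (ε / 2 * r) * (ENNReal.ofReal r * geomSum (1 / p * r) * I))) := by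
          gcongr
          exact hb.trans (by gcongr)
      _ = _ := by rw [hC₁]; ring
  have hp1 : ENNReal.ofReal p ^ (1 / r) ≠ 0 := by simp [hpr]
  have hp2 : ENNReal.ofReal p ^ (1 / r) ≠ ⊤ :=
    ENNReal.rpow_ne_top_of_nonneg hr1.le ENNReal.ofReal_ne_top
  calc ENNReal.ofReal q ^ (1 / r) * J ^ (1 / r)
      ≤ ENNReal.ofReal q ^ (1 / r) * ((2 * geomSum (ε / 2) * K) ^ r * (C₁ * I)) ^ (1 / r) := by
        gcongr
    _ = ENNReal.ofReal q ^ (1 / r) * ((2 * geomSum (ε / 2) * K) * (C₁ ^ (1 / r) * I ^ (1 / r))) := by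
        rw [ENNReal.mul_rpow_of_nonneg _ _ hr1.le, ENNReal.mul_rpow_of_nonneg C₁ _ hr1.le,
          ← ENNReal.rpow_mul, mul_one_div_cancel hs0.ne', ENNReal.rpow_one]
    _ = (ENNReal.ofReal q ^ (1 / r) / ENNReal.ofReal p ^ (1 / r) * ENNReal.ofReal p ^ (1 / r)) *
          ((2 * geomSum (ε / 2) * K) * (C₁ ^ (1 / r) * I ^ (1 / r))) := by
        rw [ENNReal.div_mul_cancel hp1 hp2]
    _ = _ := by ring

end

/-! ### Exponents and conclusion. -/

/-- Here `1 - 1/σ = 1/σ'`. The last identity places both endpoints `(1/ρ, 1/σ)` and `(1/σ', 1/ρ')`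
on the line of (ii); the inequalities make the segment between them nondegenerate. -/
lemma exponent_bounds {a b : ℝ} (had : a < d) (hb : 0 < b) :
    0 < 1 - 1 / sigmaExp d a b ∧ 1 - 1 / sigmaExp d a b < 1 / rhoExp d a b ∧
      1 / rhoExp d a b < 1 ∧
      1 - 1 / sigmaExp d a b + 1 / rhoExp d a b - 1 = (d - a) / (d - a + b) := by
  have hD : 0 < (d : ℝ) - a := by linarith
  unfold sigmaExp rhoExp
  generalize (d : ℝ) - a = D at hD
  have h1 : 1 - 1 / ((D + 2 * b) / b) = (D + b) / (D + 2 * b) := by field_simp; ring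
  have h2 : 1 / ((D + 2 * b) * (D + b) / (D ^ 2 + 3 * b * D + b ^ 2)) =
      (D ^ 2 + 3 * b * D + b ^ 2) / ((D + 2 * b) * (D + b)) := by rw [one_div_div]
  rw [h1, h2]
  refine ⟨by positivity, ?_, ?_, ?_⟩
  · rw [div_lt_div_iff₀ (by positivity) (by positivity)]
    have : 0 < (D + 2 * b) * (b * D) := by positivity
    nlinarith
  · rw [div_lt_one (by positivity)]
    nlinarith [sq_pos_of_pos hb]
  · field_simp; ring

lemma exists_restrictedKernel_fourierMeasure {a b : ℝ} (ha : 0 < a) (had : a < d) (hb : 0 < b) :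
    ∃ C : ℝ, 0 < C ∧ ∀ (μ : Measure (E d)) [IsProbabilityMeasure μ] (A B : ℝ), 1 ≤ A → 1 ≤ B →
      BallCondition μ a A → FourierDecay μ b B →
        RestrictedKernel (fourierMeasure μ) (1 / rhoExp d a b) (1 - 1 / sigmaExp d a b)
          (ENNReal.ofReal (C * normBound d a b A B)) := by
  obtain ⟨h1, h2, -, -⟩ := exponent_bounds had hb
  obtain ⟨C, hC, h⟩ := norm_form_fourierMeasure_le (d := d) ha had hb
  refine ⟨C, hC, fun μ _ A B hA hB hball hdec => ⟨continuous_fourierMeasure μ,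
    norm_fourierMeasure_le_one μ, lintegral_fourierMeasure_le ha had hb hA hB hball hdec, ?_⟩⟩
  have hK := (normBound_pos (d := d) (a := a) (b := b) hA hB)
  have key : ∀ f g : E d → ℂ, UnitFun f → UnitFun g → ‖form (fourierMeasure μ) f g‖ₑ ≤
      ENNReal.ofReal (C * normBound d a b A B) * (ENNReal.ofReal (mass f) ^ (1 / rhoExp d a b) *
        ENNReal.ofReal (mass g) ^ (1 - 1 / sigmaExp d a b)) := by
    intro f g hf hg
    have := mass_nonneg f
    have := mass_nonneg g
    rw [ENNReal.ofReal_rpow_of_nonneg (mass_nonneg f) (h1.trans h2).le,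
      ENNReal.ofReal_rpow_of_nonneg (mass_nonneg g) h1.le, ← ENNReal.ofReal_mul (by positivity),
      ← ENNReal.ofReal_mul (by positivity), ← ofReal_norm]
    exact ENNReal.ofReal_le_ofReal (h μ A B hA hB hball hdec f g hf hg)
  intro f g hf hg
  rw [mul_min]
  refine le_min (key f g hf hg) ?_
  have h3 := key _ _ hg.conj hf.conj
  rw [mass_conj, mass_conj] at h3
  rw [form_swap_conj (fourierMeasure_neg μ), ← ofReal_norm, RCLike.norm_conj, ofReal_norm,
    mul_comm (ENNReal.ofReal (mass f) ^ _)]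
  exact h3

lemma lintegral_rpow_le_lorentzOf_one (l : ℝ → ℝ≥0∞) {p : ℝ} (hp : 1 ≤ p) :
    ∫⁻ t in Set.Ioi (0 : ℝ), l t ^ (1 / p) ≤ lorentzOf l p 1 := by
  unfold lorentzOf
  rw [if_neg ENNReal.one_ne_top]
  simp only [ENNReal.toReal_one, div_one, ENNReal.rpow_one]
  calc ∫⁻ t in Set.Ioi (0 : ℝ), l t ^ (1 / p)
      = ∫⁻ t in Set.Ioi (0 : ℝ), ENNReal.ofReal t * l t ^ (1 / p) / ENNReal.ofReal t := by
        refine setLIntegral_congr_fun measurableSet_Ioi fun t ht => ?_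
        have ht0 : ENNReal.ofReal t ≠ 0 := by simpa using ht
        rw [mul_comm, ENNReal.mul_div_cancel_right ht0 ENNReal.ofReal_ne_top]
    -- For `s = 1` the normalising factor `p^{1/s}` equals `p ≥ 1`.
    _ ≤ _ := le_mul_of_one_le_left zero_le (by simpa using hp)

section

variable {k : E d → ℂ} {α' α : ℝ} {K : ℝ}

/-- A single term of the minimum in `layerInt` gives `u m ≤ K X m^β` with `X ≤ ‖f‖_{L^{p,1}}`;
dividing by `m^β` leaves `u m^{1/q} ≤ K X`. The two alternatives in `hβ` are the two endpoints. -/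
lemma RestrictedKernel.convRestrictedWeakType
    (hk : RestrictedKernel k α' α (ENNReal.ofReal K)) (hα0 : 0 < α)
    (hα : α ≤ α') (hα1 : α' ≤ 1) {p q β : ℝ} (hp : 1 ≤ p) (hq : 0 < q) (hqβ : 1 / q = 1 - β)
    (hβ : (1 / p = α' ∧ β = α) ∨ (1 / p = α ∧ β = α')) :
    ConvRestrictedWeakType k p q K := by
  intro f hf
  have hle : ∀ (l : ℝ → ℝ≥0∞) (m : ℝ≥0∞), m ≠ ⊤ → layerInt l α' α m ≤
      (∫⁻ t in Set.Ioi (0 : ℝ), l t ^ (1 / p)) * m ^ β := by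
    intro l m hm
    have hβ0 : 0 ≤ β := by rcases hβ with ⟨-, rfl⟩ | ⟨-, rfl⟩ <;> linarith
    unfold layerInt
    rw [← lintegral_mul_const' _ _ (ENNReal.rpow_ne_top_of_nonneg hβ0 hm)]
    refine lintegral_mono fun t => ?_
    rcases hβ with ⟨h1, rfl⟩ | ⟨h1, rfl⟩
    · rw [h1]; exact min_le_left _ _
    · rw [h1]; exact min_le_right _ _
  have hX : ∫⁻ t in Set.Ioi (0 : ℝ), distribution f t ^ (1 / p) ≤ lorentzNorm f p 1 :=
    lintegral_rpow_le_lorentzOf_one _ hp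
  have hfin : layerInt (distribution f) α' α 1 < ⊤ := by
    refine (hle _ 1 ENNReal.one_ne_top).trans_lt ?_
    rw [ENNReal.one_rpow, mul_one]
    exact hX.trans_lt hf.2
  obtain ⟨h1, h2, h3⟩ := hk.conv_bound hα0 hα hα1 ENNReal.ofReal_ne_top hf.1 hfin
  have hbound : lorentzNorm (conv f k) q ∞ ≤ ENNReal.ofReal K * lorentzNorm f p 1 := by
    rw [lorentzNorm_eq]
    unfold lorentzOf
    rw [if_pos rfl]
    refine iSup_le fun ⟨u, hu⟩ => ?_
    simp only
    have hu0 : ENNReal.ofReal u ≠ 0 := by simpa using hu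
    set X := ∫⁻ t in Set.Ioi (0 : ℝ), distribution f t ^ (1 / p)
    have hL : distribution (conv f k) u ≤ (ENNReal.ofReal K * X / ENNReal.ofReal u) ^ q := by
      refine le_of_forall_lt fun c hc => ?_
      obtain ⟨m, hcm, hm, hle'⟩ := h3 u hu c hc
      refine hcm.trans_le ?_
      have hm0 : m ≠ 0 := (zero_le.trans_lt hcm).ne'
      have h4 : ENNReal.ofReal u * m ^ (1 / q) * m ^ β ≤ ENNReal.ofReal K * X * m ^ β := by
        calc ENNReal.ofReal u * m ^ (1 / q) * m ^ β = ENNReal.ofReal u * m := by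
              rw [mul_assoc, ← ENNReal.rpow_add _ _ hm0 hm.ne, hqβ, sub_add_cancel,
                ENNReal.rpow_one]
          _ ≤ _ := hle'
          _ ≤ ENNReal.ofReal K * (X * m ^ β) := by gcongr; exact hle _ m hm.ne
          _ = _ := by ring
      have h5 : m ^ β ≠ 0 := (ENNReal.rpow_pos hm0.bot_lt hm.ne).ne'
      have h6 : m ^ β ≠ ⊤ := ENNReal.rpow_ne_top_of_ne_zero hm0 hm.ne
      have h7 := (ENNReal.mul_le_mul_iff_left h5 h6).1 h4
      rw [mul_comm, ← ENNReal.le_div_iff_mul_le (Or.inl hu0) (Or.inl ENNReal.ofReal_ne_top)] at h7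
      calc m = (m ^ (1 / q)) ^ q := by
            rw [← ENNReal.rpow_mul, one_div_mul_cancel hq.ne', ENNReal.rpow_one]
        _ ≤ _ := ENNReal.rpow_le_rpow h7 hq.le
    calc ENNReal.ofReal u * distribution (conv f k) u ^ (1 / q)
        ≤ ENNReal.ofReal u * ((ENNReal.ofReal K * X / ENNReal.ofReal u) ^ q) ^ (1 / q) := by
          gcongr
      _ = ENNReal.ofReal K * X := by
          rw [← ENNReal.rpow_mul, mul_one_div_cancel hq.ne', ENNReal.rpow_one,
            ENNReal.mul_div_cancel hu0 ENNReal.ofReal_ne_top]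
      _ ≤ _ := by gcongr
  exact ⟨h1, ⟨h2, hbound.trans_lt (ENNReal.mul_lt_top ENNReal.ofReal_lt_top hf.2)⟩, hbound⟩

lemma exists_convBounded_of_restrictedKernel {p q : ℝ} {s : ℝ≥0∞} (hs : 0 < s) (hα0 : 0 < α)
    (hα : α ≤ α') (hα1 : α' ≤ 1) (h1 : α < 1 / p) (h2 : 1 / p < α')
    (hq : 1 / q = 1 / p - (α + α' - 1)) :
    ∃ C : ℝ, ∀ (k : E d → ℂ) (K : ℝ), RestrictedKernel k α' α (ENNReal.ofReal K) →
      ConvBounded k p s q s (C * K) := by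
  obtain ⟨C, hC, hbd⟩ := lorentzOf_le_of_layerInt hs hα0 (hα.trans hα1) hα1 h1 h2 hq
  refine ⟨C.toReal, fun k K hk f hf => ?_⟩
  have hp : 0 < p := one_div_pos.1 (hα0.trans h1)
  have hl := antitone_distribution f
  obtain ⟨M, hM, hle⟩ := exists_dyadicSeq_le_of_lorentzOf hl hp hs hf.2
  have hfin := layerInt_one_lt_top hl hα0 (hα.trans hα1) hα1 h1 h2 hM hle
  obtain ⟨e1, e2, e3⟩ := hk.conv_bound hα0 hα hα1 ENNReal.ofReal_ne_top hf.1 hfin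
  have hb : lorentzNorm (conv f k) q s ≤ ENNReal.ofReal (C.toReal * K) * lorentzNorm f p s := by
    rw [ENNReal.ofReal_mul ENNReal.toReal_nonneg, ENNReal.ofReal_toReal hC]
    exact hbd _ _ _ hl (antitone_distribution _) hf.2 e3
  exact ⟨e1, ⟨e2, hb.trans_lt (ENNReal.mul_lt_top ENNReal.ofReal_lt_top hf.2)⟩, hb⟩

end

lemma one_div_conjExponent {p : ℝ} (hp : p ≠ 0) : 1 / Real.conjExponent p = 1 - 1 / p := by
  rw [Real.conjExponent, one_div_div, sub_div, div_self hp]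

theorem exists_convBounded {a b : ℝ} (ha : 0 < a) (had : a < d) (hb : 0 < b) (p q : ℝ) (s : ℝ≥0∞)
    (hρ : rhoExp d a b < p) (hσ : p < Real.conjExponent (sigmaExp d a b))
    (hpq : 1 / p - 1 / q = (d - a) / (d - a + b)) (hs : 0 < s) :
    ∃ C : ℝ, ∀ (μ : Measure (E d)) [IsProbabilityMeasure μ] (A B : ℝ), 1 ≤ A → 1 ≤ B →
      BallCondition μ a A → FourierDecay μ b B →
        ConvBounded (fourierMeasure μ) p s q s (C * normBound d a b A B) := by
  obtain ⟨h1, h2, h3, h4⟩ := exponent_bounds had hb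
  obtain ⟨C, hC, h⟩ := exists_restrictedKernel_fourierMeasure (d := d) ha had hb
  have hρ0 : 0 < rhoExp d a b := one_div_pos.1 (h1.trans h2)
  have hσ0 : sigmaExp d a b ≠ 0 := by
    have : 0 < (d : ℝ) - a := by linarith
    unfold sigmaExp; positivity
  obtain ⟨C', h'⟩ := exists_convBounded_of_restrictedKernel (d := d) (p := p) (q := q) hs h1
    h2.le h3.le
    (by rw [← one_div_conjExponent hσ0]; exact one_div_lt_one_div_of_lt (hρ0.trans hρ) hσ)
    (one_div_lt_one_div_of_lt hρ0 hρ) (by rw [h4]; linarith)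
  refine ⟨C' * C, fun μ _ A B hA hB hball hdec => ?_⟩
  rw [mul_assoc]
  exact h' _ _ (h μ A B hA hB hball hdec)

end SteinTomas
end

theorem proposition2p1 (d : ℕ) (a b : ℝ) (ha : 0 < a) (had : a < d) (hb : 0 < b)
    (hba : b ≤ a / 2) :
    (∃ C : ℝ, ∀ (μ : MeasureTheory.Measure (SteinTomas.E d)) [MeasureTheory.IsProbabilityMeasure μ]
      (A B : ℝ), 1 ≤ A → 1 ≤ B →
      SteinTomas.BallCondition μ a A → SteinTomas.FourierDecay μ b B →
        SteinTomas.ConvRestrictedWeakType (SteinTomas.fourierMeasure μ)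
          (SteinTomas.rhoExp d a b) (SteinTomas.sigmaExp d a b)
          (C * SteinTomas.normBound d a b A B) ∧
        SteinTomas.ConvRestrictedWeakType (SteinTomas.fourierMeasure μ)
          (Real.conjExponent (SteinTomas.sigmaExp d a b))
          (Real.conjExponent (SteinTomas.rhoExp d a b))
          (C * SteinTomas.normBound d a b A B)) ∧
    (∀ (p q : ℝ) (s : ENNReal), SteinTomas.rhoExp d a b < p →
      p < Real.conjExponent (SteinTomas.sigmaExp d a b) →
      1 / p - 1 / q = (d - a) / (d - a + b) → 0 < s →
      ∃ C : ℝ, ∀ (μ : MeasureTheory.Measure (SteinTomas.E d))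
        [MeasureTheory.IsProbabilityMeasure μ] (A B : ℝ), 1 ≤ A → 1 ≤ B →
        SteinTomas.BallCondition μ a A → SteinTomas.FourierDecay μ b B →
          SteinTomas.ConvBounded (SteinTomas.fourierMeasure μ) p s q s
            (C * SteinTomas.normBound d a b A B)) ∧
    (∀ s : ENNReal, 0 < s →
      ∃ C : ℝ, ∀ (μ : MeasureTheory.Measure (SteinTomas.E d))
        [MeasureTheory.IsProbabilityMeasure μ] (A B : ℝ), 1 ≤ A → 1 ≤ B →
        SteinTomas.BallCondition μ a A → SteinTomas.FourierDecay μ b B →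
          SteinTomas.ConvBounded (SteinTomas.fourierMeasure μ)
            (SteinTomas.pCirc d a b) s (Real.conjExponent (SteinTomas.pCirc d a b)) s
            (C * SteinTomas.normBound d a b A B)) := by
  have hD : 0 < (d : ℝ) - a := by linarith
  obtain ⟨h1, h2, h3, h4⟩ := SteinTomas.exponent_bounds had hb
  have hρ : 0 < SteinTomas.rhoExp d a b := one_div_pos.1 (h1.trans h2)
  have hσ : 0 < SteinTomas.sigmaExp d a b := by unfold SteinTomas.sigmaExp; positivity
  have eσ := SteinTomas.one_div_conjExponent hσ.ne'
  have eρ := SteinTomas.one_div_conjExponent hρ.ne'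
  have hσ' : 0 < Real.conjExponent (SteinTomas.sigmaExp d a b) := by
    rw [← one_div_pos, eσ]; exact h1
  refine ⟨?_, SteinTomas.exists_convBounded ha had hb, fun s hs => ?_⟩
  · obtain ⟨C, -, h⟩ := SteinTomas.exists_restrictedKernel_fourierMeasure (d := d) ha had hb
    refine ⟨C, fun μ _ A B hA hB hball hdec => ⟨?_, ?_⟩⟩
    · refine (h μ A B hA hB hball hdec).convRestrictedWeakType h1 h2.le h3.le ?_ hσ
        (sub_sub_cancel _ _).symm (Or.inl ⟨rfl, rfl⟩)
      rw [← one_div_le_one_div hρ one_pos, one_div_one]; exact h3.le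
    · refine (h μ A B hA hB hball hdec).convRestrictedWeakType h1 h2.le h3.le ?_ ?_
        eρ (Or.inr ⟨eσ, rfl⟩)
      · rw [← one_div_le_one_div hσ' one_pos, one_div_one, eσ]; exact (h2.trans h3).le
      · rw [← one_div_pos, eρ]; linarith
  · have hp : 0 < SteinTomas.pCirc d a b := by unfold SteinTomas.pCirc; positivity
    -- By the gap identity `h4`, this says that `1/p_∘` is the midpoint of `1/ρ` and `1/σ'`, hence
    -- strictly between them.
    have ep : 2 * (1 / SteinTomas.pCirc d a b) - 1 = (d - a) / (d - a + b) := by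
      unfold SteinTomas.pCirc; field_simp; ring
    refine SteinTomas.exists_convBounded ha had hb _ _ s ?_ ?_ ?_ hs
    · rw [← one_div_lt_one_div hp hρ]; linarith
    · rw [← one_div_lt_one_div hσ' hp, eσ]; linarith
    · rw [SteinTomas.one_div_conjExponent hp.ne']; linarith
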